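/- Let $X=\{0,1\}$, let $X^*$ be the set of finite words over $X$, regarded as the rooted binary tree with an edge from $w$ to $wx$ for $w\in X^*$, $x\in X$, and let $X^{[n]}$ be the subtree of words of length at most $n$. Put $G=\mathrm{Aut}(X^*)$ and $G(n)=\mathrm{Aut}(X^{[n]})$, and let $\pi_n$ denote restriction to $X^{[n]}$. For $g\in G$ and $w\in X^*$ the section $g_w\in G$ is defined by $g(wv)=g(w)\,g_w(v)$ for all $v\in X^*$; sections $p_x\in G(d-1)$ of $p\in G(d)$ at letters $x\in X$ are defined in the same way. For $d\ge 1$, a subgroup $P\le G(d)$ is an *essential pattern group* of size $d$ if for every $p\in P$ and $x\in X$ there is $q\in P$ with $\pi_{d-1}(q)=p_x$; it defines the subgroup $G_P=\{g\in G : \pi_d(g_w)\in P \text{ for all } w\in X^*\}$ of $G$. A subgroup $H\le G$ is *finitely constrained* if $H=G_P$ for some essential pattern group $P$ of some size, and it is *defined by patterns of size $d$* if $d$ is the minimal size of an essential pattern group $P$ with $H=G_P$. Equip $G$ with the profinite metric given by $d(g,g)=0$ and, for $g\ne h$, $d(g,h)=1/|G(n)|$, where $n$ is the largest integer with $\pi_n(g)=\pi_n(h)$;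 the Hausdorff dimension of a subgroup of $G$ is taken with respect to this metric. **Theorem.** For every integer $d\ge 2$ there are exactly $2^{2d-3}$ finitely constrained subgroups of $G=\mathrm{Aut}(X^*)$ that are defined by patterns of size $d$ and have Hausdorff dimension $1-\frac{2}{2^{d-1}}$. -/

import Mathlib

/-! Automorphism groups of the infinite rooted binary tree and of its finite truncations,
sections, essential pattern groups, finitely constrained groups, and the profinite metric. -/

namespace BinaryTree

/-- The edge relation of the rooted binary tree `X^*`, `X = {0,1}`: there is an edge from `w`
to `wx` for every finite word `w` and every letter `x`. -/
def Edge (w v : List Bool) : Prop := ∃ x : Bool, v = w ++ [x]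

/-- `X^{[d]}`: the words of length at most `d`. -/
abbrev FinWord (d : ℕ) : Type := {w : List Bool // w.length ≤ d}

/-- The edge relation of the finite tree `X^{[d]}`. -/
def FinEdge (d : ℕ) (w v : FinWord d) : Prop := Edge w.1 v.1

/-- `G = Aut(X^*)`, with composition as multiplication. -/
abbrev TreeAut : Type := Edge ≃r Edge

/-- `G(d) = Aut(X^{[d]})`, with composition as multiplication. -/
abbrev FinTreeAut (d : ℕ) : Type := FinEdge d ≃r FinEdge d

theorem edge_append_iff (u a b : List Bool) : Edge (u ++ a) (u ++ b) ↔ Edge a b := by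
  simp [Edge, List.append_assoc]

theorem not_edge_nil (w : List Bool) : ¬ Edge w [] := by
  simp [Edge]

theorem edge_snoc (w : List Bool) (x : Bool) : Edge w (w ++ [x]) := ⟨x, rfl⟩

/-! ### The infinite tree -/

theorem treeAut_nil (g : TreeAut) : g [] = [] := by
  rcases List.eq_nil_or_concat (g []) with h | ⟨u, x, h⟩
  · exact h
  · exfalso
    have h1 : Edge (g (g.symm u)) (g []) := by
      rw [RelIso.apply_symm_apply, h, List.concat_eq_append]
      exact edge_snoc u x
    exact not_edge_nil _ (g.map_rel_iff.1 h1)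

theorem treeAut_append (g : TreeAut) (w v : List Bool) :
    ∃ u : List Bool, u.length = v.length ∧ g (w ++ v) = g w ++ u := by
  induction v using List.reverseRecOn with
  | nil => exact ⟨[], rfl, by simp⟩
  | append_singleton v x ih =>
    obtain ⟨u, hu, h⟩ := ih
    obtain ⟨y, hy⟩ : Edge (g (w ++ v)) (g (w ++ v ++ [x])) := g.map_rel_iff.2 (edge_snoc _ x)
    exact ⟨u ++ [y], by simp [hu], by rw [← List.append_assoc, hy, h, List.append_assoc]⟩

theorem length_treeAut (g : TreeAut) (w : List Bool) : (g w).length = w.length := by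
  obtain ⟨u, hu, h⟩ := treeAut_append g [] w
  rw [List.nil_append] at h
  rw [h, treeAut_nil, List.nil_append, hu]

/-- The word `g_w(v)`, obtained from `g(wv)` by deleting its prefix `g(w)`. -/
def sectionFun (g : TreeAut) (w v : List Bool) : List Bool := (g (w ++ v)).drop w.length

theorem sectionFun_spec (g : TreeAut) (w v : List Bool) :
    g (w ++ v) = g w ++ sectionFun g w v := by
  obtain ⟨u, -, h⟩ := treeAut_append g w v
  rw [sectionFun, h, ← length_treeAut g w, List.drop_left]

theorem sectionFun_inv (g : TreeAut) (w v : List Bool) :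
    sectionFun g⁻¹ (g w) (sectionFun g w v) = v := by
  have h : g⁻¹ (g w ++ sectionFun g w v) = w ++ v := by
    rw [← sectionFun_spec]; exact g.symm_apply_apply _
  rw [sectionFun, h, length_treeAut, List.drop_left]

/-- The section `g_w` of `g` at `w`: the automorphism with `g(wv) = g(w) g_w(v)` for all `v`. -/
def treeSection (g : TreeAut) (w : List Bool) : TreeAut where
  toFun := sectionFun g w
  invFun := sectionFun g⁻¹ (g w)
  left_inv := sectionFun_inv g w
  right_inv := fun v => by
    have h := sectionFun_inv g⁻¹ (g w) v
    rw [inv_inv] at h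
    rwa [show g⁻¹ (g w) = w from g.symm_apply_apply w] at h
  map_rel_iff' := by
    intro a b
    show Edge (sectionFun g w a) (sectionFun g w b) ↔ Edge a b
    rw [← edge_append_iff (g w), ← sectionFun_spec, ← sectionFun_spec, g.map_rel_iff,
      edge_append_iff]

theorem treeSection_spec (g : TreeAut) (w v : List Bool) :
    g (w ++ v) = g w ++ treeSection g w v := sectionFun_spec g w v

theorem treeSection_one (w : List Bool) : treeSection 1 w = 1 := by
  ext1 v
  exact List.append_cancel_left (treeSection_spec 1 w v).symm

theorem treeSection_mul (g h : TreeAut) (w : List Bool) :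
    treeSection (g * h) w = treeSection g (h w) * treeSection h w := by
  ext1 v
  have h1 := treeSection_spec (g * h) w v
  rw [RelIso.mul_apply, RelIso.mul_apply, treeSection_spec h, treeSection_spec g] at h1
  exact (List.append_cancel_left h1).symm

theorem treeSection_inv (g : TreeAut) (w : List Bool) :
    treeSection g⁻¹ w = (treeSection g (g⁻¹ w))⁻¹ := by
  have h := treeSection_mul g g⁻¹ w
  rw [mul_inv_cancel, treeSection_one] at h
  exact eq_inv_of_mul_eq_one_right h.symm

/-- The homomorphism `π_k : G → G(k)`, restriction to the words of length at most `k`. -/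
def proj (k : ℕ) : TreeAut →* FinTreeAut k where
  toFun g :=
    { toFun := fun v => ⟨g v.1, (length_treeAut g v.1).trans_le v.2⟩
      invFun := fun v => ⟨g⁻¹ v.1, (length_treeAut g⁻¹ v.1).trans_le v.2⟩
      left_inv := fun v => Subtype.ext (g.symm_apply_apply v.1)
      right_inv := fun v => Subtype.ext (g.apply_symm_apply v.1)
      map_rel_iff' := g.map_rel_iff }
  map_one' := rfl
  map_mul' _ _ := rfl

theorem proj_apply (k : ℕ) (g : TreeAut) (v : FinWord k) : (proj k g v).1 = g v.1 := rfl

/-! ### The finite trees -/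

theorem finTreeAut_nil {d : ℕ} (g : FinTreeAut d) : (g ⟨[], Nat.zero_le d⟩).1 = [] := by
  rcases List.eq_nil_or_concat (g ⟨[], Nat.zero_le d⟩).1 with h | ⟨u, x, h⟩
  · exact h
  · exfalso
    rw [List.concat_eq_append] at h
    have hu : u.length ≤ d := by
      have h2 := (g ⟨[], Nat.zero_le d⟩).2
      rw [h, List.length_append] at h2
      omega
    have h1 : FinEdge d (g (g.symm ⟨u, hu⟩)) (g ⟨[], Nat.zero_le d⟩) := by
      rw [RelIso.apply_symm_apply, FinEdge, h]
      exact edge_snoc u x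
    exact not_edge_nil _ (g.map_rel_iff.1 h1)

theorem finTreeAut_append {d : ℕ} (g : FinTreeAut d) (w v : List Bool) (hw : w.length ≤ d)
    (hwv : (w ++ v).length ≤ d) :
    ∃ u : List Bool, u.length = v.length ∧ (g ⟨w ++ v, hwv⟩).1 = (g ⟨w, hw⟩).1 ++ u := by
  induction v using List.reverseRecOn with
  | nil => exact ⟨[], rfl, by simp⟩
  | append_singleton v x ih =>
    have hv : (w ++ v).length ≤ d := by
      simp only [List.length_append, List.length_singleton] at hwv ⊢
      omega
    obtain ⟨u, hu, h⟩ := ih hv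
    have he : FinEdge d (g ⟨w ++ v, hv⟩) (g ⟨w ++ (v ++ [x]), hwv⟩) :=
      g.map_rel_iff.2 ⟨x, (List.append_assoc _ _ _).symm⟩
    obtain ⟨y, hy⟩ := he
    exact ⟨u ++ [y], by simp [hu], by rw [hy, h, List.append_assoc]⟩

theorem length_finTreeAut {d : ℕ} (g : FinTreeAut d) (w : FinWord d) :
    (g w).1.length = w.1.length := by
  obtain ⟨w, hw⟩ := w
  obtain ⟨u, hu, h⟩ := finTreeAut_append g [] w (Nat.zero_le d) hw
  simp only [List.nil_append] at h
  rw [h, finTreeAut_nil, List.nil_append, hu]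

/-- The homomorphism `π_{n,k} : G(n) → G(k)` for `k ≤ n`, restriction to the words of length
at most `k`. -/
def finProj {n k : ℕ} (hk : k ≤ n) : FinTreeAut n →* FinTreeAut k where
  toFun g :=
    { toFun := fun v => ⟨(g ⟨v.1, v.2.trans hk⟩).1, (length_finTreeAut g _).trans_le v.2⟩
      invFun := fun v => ⟨(g⁻¹ ⟨v.1, v.2.trans hk⟩).1, (length_finTreeAut g⁻¹ _).trans_le v.2⟩
      left_inv := fun v => by
        have h := congrArg Subtype.val (g.symm_apply_apply (⟨v.1, v.2.trans hk⟩ : FinWord n))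
        exact Subtype.ext h
      right_inv := fun v => by
        have h := congrArg Subtype.val (g.apply_symm_apply (⟨v.1, v.2.trans hk⟩ : FinWord n))
        exact Subtype.ext h
      map_rel_iff' := fun {a b} => g.map_rel_iff (a := (⟨a.1, a.2.trans hk⟩ : FinWord n))
        (b := ⟨b.1, b.2.trans hk⟩) }
  map_one' := rfl
  map_mul' _ _ := rfl

/-- Concatenation of a word of length `d - k` and a word of length at most `k`. -/
def FinWord.cat {d k : ℕ} (w : FinWord d) (h : w.1.length + k = d) (v : FinWord k) : FinWord d :=
  ⟨w.1 ++ v.1, by have := v.2; rw [List.length_append]; omega⟩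

/-- The word `g_w(v)`, obtained from `g(wv)` by deleting its prefix `g(w)`. -/
def finSectionFun {d k : ℕ} (g : FinTreeAut d) (w : FinWord d) (h : w.1.length + k = d)
    (v : FinWord k) : FinWord k :=
  ⟨(g (w.cat h v)).1.drop w.1.length, by
    have := v.2
    rw [List.length_drop, length_finTreeAut, FinWord.cat, List.length_append]
    omega⟩

theorem finSectionFun_spec {d k : ℕ} (g : FinTreeAut d) (w : FinWord d)
    (h : w.1.length + k = d) (v : FinWord k) :
    (g (w.cat h v)).1 = (g w).1 ++ (finSectionFun g w h v).1 := by
  obtain ⟨u, -, hu⟩ := finTreeAut_append g w.1 v.1 w.2 (w.cat h v).2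
  have hu' : (g (w.cat h v)).1 = (g w).1 ++ u := hu
  have h1 : (finSectionFun g w h v).1 = u := by
    show (g (w.cat h v)).1.drop w.1.length = u
    rw [hu', ← length_finTreeAut g w, List.drop_left]
  rw [hu', h1]

theorem finSection_length {d k : ℕ} (g : FinTreeAut d) (w : FinWord d)
    (h : w.1.length + k = d) : (g w).1.length + k = d := by
  rw [length_finTreeAut, h]

theorem finSectionFun_inv {d k : ℕ} (g : FinTreeAut d) (w : FinWord d)
    (h : w.1.length + k = d) (v : FinWord k) :
    finSectionFun g⁻¹ (g w) (finSection_length g w h) (finSectionFun g w h v) = v := by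
  have h1 : (g w).cat (finSection_length g w h) (finSectionFun g w h v) = g (w.cat h v) :=
    Subtype.ext (finSectionFun_spec g w h v).symm
  apply Subtype.ext
  show List.drop (g w).1.length
    (g.symm ((g w).cat (finSection_length g w h) (finSectionFun g w h v))).1 = v.1
  rw [h1, RelIso.symm_apply_apply, length_finTreeAut]
  exact List.drop_left

/-- The finite section `g_w ∈ G(d - |w|)` of `g ∈ G(d)` at a word `w`: the automorphism with
`g(wv) = g(w) g_w(v)` for all words `v` of length at most `k = d - |w|`. -/
def finSection {d k : ℕ} (g : FinTreeAut d) (w : FinWord d) (h : w.1.length + k = d) :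
    FinTreeAut k where
  toFun := finSectionFun g w h
  invFun := finSectionFun g⁻¹ (g w) (finSection_length g w h)
  left_inv := finSectionFun_inv g w h
  right_inv := fun v => by
    have h1 := finSectionFun_inv g⁻¹ (g w) (finSection_length g w h) v
    have h2 : g⁻¹ (g w) = w := g.symm_apply_apply w
    have h3 : g⁻¹⁻¹ = g := inv_inv g
    simpa only [h2, h3] using h1
  map_rel_iff' := by
    intro a b
    show Edge (finSectionFun g w h a).1 (finSectionFun g w h b).1 ↔ Edge a.1 b.1
    rw [← edge_append_iff (g w).1, ← finSectionFun_spec, ← finSectionFun_spec]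
    exact (g.map_rel_iff (a := w.cat h a) (b := w.cat h b)).trans (edge_append_iff w.1 a.1 b.1)

theorem finSection_spec {d k : ℕ} (g : FinTreeAut d) (w : FinWord d) (h : w.1.length + k = d)
    (v : FinWord k) : (g (w.cat h v)).1 = (g w).1 ++ (finSection g w h v).1 :=
  finSectionFun_spec g w h v

/-! ### Pattern groups and finitely constrained groups -/

/-- The one-letter word `x`, as a vertex of `X^{[k+1]}`. -/
def letter (k : ℕ) (x : Bool) : FinWord (k + 1) := ⟨[x], Nat.le_add_left 1 k⟩

/-- `P ≤ G(d)`, `d = k + 1 ≥ 1`, is an essential pattern group: for all `p ∈ P` and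
`x ∈ {0,1}` there is `q ∈ P` with `π_{d-1}(q) = p_x`. -/
def IsEssentialPatternGroup {k : ℕ} (P : Subgroup (FinTreeAut (k + 1))) : Prop :=
  ∀ p ∈ P, ∀ x : Bool, ∃ q ∈ P,
    finProj (Nat.le_succ k) q = finSection p (letter k x) (Nat.add_comm 1 k)

/-- `G_P = {g ∈ G : π_d(g_w) ∈ P for all w ∈ X^*}`. -/
def patternGroup {d : ℕ} (P : Subgroup (FinTreeAut d)) : Subgroup TreeAut where
  carrier := {g | ∀ w : List Bool, proj d (treeSection g w) ∈ P}
  one_mem' w := by rw [treeSection_one, map_one]; exact P.one_mem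
  mul_mem' := fun {g h} hg hh w => by
    rw [treeSection_mul, map_mul]; exact P.mul_mem (hg _) (hh _)
  inv_mem' := fun {g} hg w => by
    rw [treeSection_inv, map_inv]; exact P.inv_mem (hg _)

/-- `H = G_P` for some essential pattern group `P` of size `d ≥ 1`. -/
def HasPatternsOfSize (H : Subgroup TreeAut) (d : ℕ) : Prop :=
  ∃ (k : ℕ) (P : Subgroup (FinTreeAut (k + 1))),
    k + 1 = d ∧ IsEssentialPatternGroup P ∧ H = patternGroup P

/-- `H` is a finitely constrained group defined by patterns of size `d`: `d` is the minimal
size of an essential pattern group `P` with `H = G_P`. -/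
def IsDefinedByPatternsOfSize (H : Subgroup TreeAut) (d : ℕ) : Prop :=
  IsLeast {n : ℕ | HasPatternsOfSize H n} d

/-! ### The profinite metric -/

instance finite_finWord (d : ℕ) : Finite (FinWord d) :=
  (List.finite_length_le Bool d).to_subtype

instance finite_finTreeAut (d : ℕ) : Finite (FinTreeAut d) :=
  Finite.of_injective (fun g : FinTreeAut d => (g : FinWord d → FinWord d))
    DFunLike.coe_injective

theorem proj_surjective (k : ℕ) : Function.Surjective (proj k) := by
  intro p
  have key : ∀ (q : FinTreeAut k) (w : List Bool),
      ((q ⟨w.take k, List.length_take_le k w⟩).1 ++ w.drop k).take k =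
        (q ⟨w.take k, List.length_take_le k w⟩).1 ∧
      ((q ⟨w.take k, List.length_take_le k w⟩).1 ++ w.drop k).drop k = w.drop k := by
    intro q w
    have hl := length_finTreeAut q ⟨w.take k, List.length_take_le k w⟩
    simp only [List.length_take] at hl
    rcases le_total k w.length with h | h
    · have hl' : (q ⟨w.take k, List.length_take_le k w⟩).1.length = k := by omega
      exact ⟨List.take_left' hl', List.drop_left' hl'⟩
    · rw [List.drop_eq_nil_of_le h, List.append_nil]
      exact ⟨List.take_of_length_le (by omega), List.drop_eq_nil_of_le (by omega)⟩
  let F : FinTreeAut k → List Bool → List Bool := fun q w =>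
    (q ⟨w.take k, List.length_take_le k w⟩).1 ++ w.drop k
  have hF : ∀ q w, F q⁻¹ (F q w) = w := by
    intro q w
    have h1 : (⟨(F q w).take k, List.length_take_le k _⟩ : FinWord k) =
        q ⟨w.take k, List.length_take_le k w⟩ := Subtype.ext (key q w).1
    show (q.symm ⟨(F q w).take k, List.length_take_le k _⟩).1 ++ (F q w).drop k = w
    rw [h1, RelIso.symm_apply_apply, (key q w).2, List.take_append_drop]
  have hE : ∀ q a b, Edge a b → Edge (F q a) (F q b) := by
    rintro q a b ⟨x, rfl⟩
    rcases lt_or_ge a.length k with h | h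
    · have hb : (a ++ [x]).length ≤ k := by simp; omega
      have e1 : F q a = (q ⟨a, h.le⟩).1 := by
        simp [F, List.take_of_length_le h.le, List.drop_eq_nil_of_le h.le]
      have e2 : F q (a ++ [x]) = (q ⟨a ++ [x], hb⟩).1 := by
        simp only [F, List.take_of_length_le hb, List.drop_eq_nil_of_le hb, List.append_nil]
      rw [e1, e2]
      have h3 : FinEdge k ⟨a, h.le⟩ ⟨a ++ [x], hb⟩ := edge_snoc a x
      exact q.map_rel_iff.2 h3
    · refine ⟨x, ?_⟩
      simp only [F, List.take_append_of_le_length h, List.drop_append_of_le_length h,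
        List.append_assoc]
  have hF' : ∀ q w, F q (F q⁻¹ w) = w := by
    intro q w
    have := hF q⁻¹ w
    rwa [inv_inv] at this
  refine ⟨⟨⟨F p, F p⁻¹, hF p, hF' p⟩, ?_⟩, ?_⟩
  · intro a b
    refine ⟨fun h => ?_, hE p a b⟩
    have := hE p⁻¹ _ _ h
    simpa [hF] using this
  · ext1 v
    apply Subtype.ext
    show F p v.1 = (p v).1
    simp only [F, List.take_of_length_le v.2, List.drop_eq_nil_of_le v.2, List.append_nil]

theorem proj_eq_of_le {m n : ℕ} (hmn : m ≤ n) {g h : TreeAut} (e : proj n g = proj n h) :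
    proj m g = proj m h := by
  ext1 v
  have h1 := congrArg Subtype.val (DFunLike.congr_fun e (⟨v.1, v.2.trans hmn⟩ : FinWord n))
  exact Subtype.ext h1

theorem exists_proj_ne {g h : TreeAut} (hgh : g ≠ h) : ∃ n, proj (n + 1) g ≠ proj (n + 1) h := by
  by_contra hc
  push Not at hc
  apply hgh
  ext1 v
  have := proj_eq_of_le (Nat.le_succ v.length) (hc v.length)
  exact congrArg Subtype.val (DFunLike.congr_fun this (⟨v, le_rfl⟩ : FinWord v.length))

theorem proj_zero_eq (g h : TreeAut) : proj 0 g = proj 0 h := by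
  ext1 v
  apply Subtype.ext
  obtain ⟨v, hv⟩ := v
  obtain rfl : v = [] := List.eq_nil_of_length_eq_zero (Nat.le_zero.1 hv)
  rw [proj_apply, proj_apply, treeAut_nil, treeAut_nil]

theorem card_finTreeAut_mono {m n : ℕ} (hmn : m ≤ n) :
    Nat.card (FinTreeAut m) ≤ Nat.card (FinTreeAut n) := by
  refine Nat.card_le_card_of_surjective (finProj hmn) fun p => ?_
  obtain ⟨g, rfl⟩ := proj_surjective m p
  exact ⟨proj n g, rfl⟩

/-- For `g ≠ h`, the largest `n` with `π_n(g) = π_n(h)`, given as the least `n` with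
`π_{n+1}(g) ≠ π_{n+1}(h)`. -/
noncomputable def agreeLevel (g h : TreeAut) : ℕ := sInf {n : ℕ | proj (n + 1) g ≠ proj (n + 1) h}

theorem proj_agreeLevel (g h : TreeAut) : proj (agreeLevel g h) g = proj (agreeLevel g h) h := by
  rcases hn : agreeLevel g h with _ | n
  · exact proj_zero_eq g h
  · by_contra hc
    have : agreeLevel g h ≤ n := Nat.sInf_le hc
    omega

theorem le_agreeLevel {g h : TreeAut} (hgh : g ≠ h) {n : ℕ} (e : proj n g = proj n h) :
    n ≤ agreeLevel g h := by
  by_contra hc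
  have h1 : proj (agreeLevel g h + 1) g ≠ proj (agreeLevel g h + 1) h :=
    Nat.sInf_mem (s := {n : ℕ | proj (n + 1) g ≠ proj (n + 1) h}) (exists_proj_ne hgh)
  exact h1 (proj_eq_of_le (by omega) e)

open Classical in
/-- The profinite distance: `d(g,h) = 1 / |G(n)|` with `n` the largest integer such that
`π_n(g) = π_n(h)`, and `d(g,g) = 0`. -/
noncomputable def profiniteDist (g h : TreeAut) : ℝ :=
  if g = h then 0 else 1 / (Nat.card (FinTreeAut (agreeLevel g h)) : ℝ)

theorem card_finTreeAut_pos (n : ℕ) : (0 : ℝ) < (Nat.card (FinTreeAut n) : ℝ) :=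
  Nat.cast_pos.2 Nat.card_pos

theorem profiniteDist_nonneg (g h : TreeAut) : 0 ≤ profiniteDist g h := by
  rw [profiniteDist]
  split_ifs
  · exact le_rfl
  · exact (one_div_pos.2 (card_finTreeAut_pos _)).le

theorem profiniteDist_comm (g h : TreeAut) : profiniteDist g h = profiniteDist h g := by
  have : agreeLevel g h = agreeLevel h g := by simp only [agreeLevel, ne_comm]
  by_cases hgh : g = h
  · rw [hgh]
  · rw [profiniteDist, profiniteDist, if_neg hgh, if_neg (Ne.symm hgh), this]

theorem profiniteDist_triangle (g h k : TreeAut) :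
    profiniteDist g k ≤ profiniteDist g h + profiniteDist h k := by
  by_cases h1 : g = h
  · subst h1; simp [profiniteDist]
  by_cases h2 : h = k
  · subst h2; simp [profiniteDist]
  by_cases h3 : g = k
  · subst h3
    rw [show profiniteDist g g = 0 by simp [profiniteDist]]
    exact add_nonneg (profiniteDist_nonneg _ _) (profiniteDist_nonneg _ _)
  have p1 := profiniteDist_nonneg g h
  have p2 := profiniteDist_nonneg h k
  have hle : ∀ n, proj n g = proj n k →
      profiniteDist g k ≤ 1 / (Nat.card (FinTreeAut n) : ℝ) := fun n hn => by
    rw [profiniteDist, if_neg h3]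
    exact one_div_le_one_div_of_le (card_finTreeAut_pos _)
      (Nat.cast_le.2 (card_finTreeAut_mono (le_agreeLevel h3 hn)))
  rcases le_total (agreeLevel g h) (agreeLevel h k) with hl | hl
  · have := hle _ ((proj_agreeLevel g h).trans (proj_eq_of_le hl (proj_agreeLevel h k)))
    rw [show profiniteDist g h = 1 / (Nat.card (FinTreeAut (agreeLevel g h)) : ℝ) by
      rw [profiniteDist, if_neg h1]] at *
    linarith
  · have := hle _ ((proj_eq_of_le hl (proj_agreeLevel g h)).trans (proj_agreeLevel h k))
    rw [show profiniteDist h k = 1 / (Nat.card (FinTreeAut (agreeLevel h k)) : ℝ) by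
      rw [profiniteDist, if_neg h2]] at *
    linarith

/-- `G = Aut(X^*)` as a metric space with the profinite metric. -/
noncomputable instance treeAutMetricSpace : MetricSpace TreeAut where
  dist := profiniteDist
  dist_self g := by simp [profiniteDist]
  dist_comm := profiniteDist_comm
  dist_triangle := profiniteDist_triangle
  eq_of_dist_eq_zero := fun {g h} e => by
    by_contra hne
    have e' : profiniteDist g h = 0 := e
    rw [profiniteDist, if_neg hne] at e'
    exact (one_div_pos.2 (card_finTreeAut_pos _)).ne' e'

/-- The Hausdorff dimension of a subgroup of `Aut(X^*)` with respect to the profinite metric. -/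
noncomputable def hausdorffDim (H : Subgroup TreeAut) : ENNReal := dimH (H : Set TreeAut)

end BinaryTree

namespace BinaryTree

/-! ### Portraits -/

/-! Write d = n + 2, and let W_m be the group of level-m portraits of the elements of H that fix
level m, a subgroup of all functions from level m to F_2. A finitely constrained group is the same
as a self-similar group whose membership is decided by patterns of some fixed size
(`hasPatternsOfSize_iff`). Gluing elements under a trivial root gives W_{m+1} = W_m × W_m once m + 1
≥ d (`levelGroup_succ_eq`). Hence the orders of the quotients π_m(H) are known from some level on,
and covering by cylinders together with Haar measure gives dimension log_2 |W_{n+1}| / 2^{n+1}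
(`hausdorffDim_eq`). The prescribed dimension therefore says that W_{n+1} has index four.

If W_n were not everything, W_n × W_n would already have index at least four, so W_{n+1} would equal
it and patterns of size n + 1 would suffice, against minimality. Thus W_n is full and H maps onto
G(n+1). Then W_{n+1} is invariant under all of G(n+1), and an element of fourth power one acting on
the quotient of order four forces W_{n+1} to consist of the functions with sum zero on each half
(`levelGroup_eq_square_sumZero`).

With W_{n+1} known, H is determined by the two half-sums on level n + 1 as functions of an element
of G(n+1). They form a cocycle with values in the permutation module of the two letters. As in
Shapiro's lemma, it reduces to the value at the root flip and two homomorphisms to F_2. Each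
homomorphism is, up to a fixed term, a combination of the sums of activities on levels 0, ..., n - 1
(`exists_levelSum_combination`, `exists_coeffs_of_cocycle`). This gives n + n + 1 = 2d - 3 free
bits. Conversely every choice of bits defines such a group, and different choices give different
groups (`isDefinedByPatternsOfSize_constraintGroup`, `constraintGroup_injective`). -/

/-- The letter `x`, changed if and only if `a ≠ 0`. -/
def flip (a : ZMod 2) (x : Bool) : Bool := if a = 0 then x else !x

@[simp] theorem flip_zero (x : Bool) : flip 0 x = x := by simp [flip]

theorem flip_one (x : Bool) : flip 1 x = !x := by simp [flip]

@[simp] theorem flip_flip (a b : ZMod 2) (x : Bool) : flip a (flip b x) = flip (a + b) x := by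
  revert a b x; decide

theorem flip_left_injective (x : Bool) : Function.Injective fun a => flip a x := by
  intro a b; revert a b x; decide

theorem add_self_zmod_two (a : ZMod 2) : a + a = 0 := by
  revert a; decide

theorem zmod_two_cases (a : ZMod 2) : a = 0 ∨ a = 1 := by
  revert a; decide

theorem exists_flip_eq (x y : Bool) : ∃ a : ZMod 2, flip a x = y := by
  revert x y; decide

theorem flip_flip_self (a : ZMod 2) (x : Bool) : flip a (flip a x) = x := by
  rw [flip_flip, add_self_zmod_two, flip_zero]

theorem exists_act (g : TreeAut) (w : List Bool) :
    ∃ a : ZMod 2, ∀ x, g (w ++ [x]) = g w ++ [flip a x] := by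
  obtain ⟨y, hy⟩ : Edge (g w) (g (w ++ [false])) := g.map_rel_iff.2 (edge_snoc w false)
  obtain ⟨z, hz⟩ : Edge (g w) (g (w ++ [true])) := g.map_rel_iff.2 (edge_snoc w true)
  have hyz : y ≠ z := by
    rintro rfl
    have := g.injective (hy.trans hz.symm)
    simp at this
  refine ⟨if y then 1 else 0, ?_⟩
  rintro (_ | _)
  · rw [hy]; cases y <;> simp [flip]
  · rw [hz]; cases y <;> cases z <;> simp_all [flip]

/-- The activity of `g` at the vertex `w`: `1` if `g_w` exchanges the two letters, `0`
otherwise. -/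
noncomputable def act (g : TreeAut) (w : List Bool) : ZMod 2 := (exists_act g w).choose

theorem act_spec (g : TreeAut) (w : List Bool) (x : Bool) :
    g (w ++ [x]) = g w ++ [flip (act g w) x] := (exists_act g w).choose_spec x

theorem act_unique {g : TreeAut} {w : List Bool} {x : Bool} {a : ZMod 2}
    (h : g (w ++ [x]) = g w ++ [flip a x]) : act g w = a := by
  rw [act_spec] at h
  have := List.append_cancel_left h
  exact flip_left_injective x (by simpa using this)

@[simp] theorem act_one (w : List Bool) : act 1 w = 0 :=
  act_unique (x := false) (by simp)

theorem act_mul (g h : TreeAut) (w : List Bool) : act (g * h) w = act g (h w) + act h w :=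
  act_unique (x := false) (by
    rw [RelIso.mul_apply, act_spec, act_spec, RelIso.mul_apply, flip_flip])

theorem act_treeSection (g : TreeAut) (w v : List Bool) :
    act (treeSection g w) v = act g (w ++ v) :=
  act_unique (x := false) (by
    apply List.append_cancel_left (as := g w)
    rw [← List.append_assoc, ← treeSection_spec, ← treeSection_spec, ← List.append_assoc,
      act_spec])

theorem apply_eq_of_act_eq {g h : TreeAut} (w : List Bool)
    (H : ∀ v, v.length < w.length → act g v = act h v) : g w = h w := by
  induction w using List.reverseRecOn with
  | nil => rw [treeAut_nil, treeAut_nil]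
  | append_singleton v x ih =>
    rw [act_spec, act_spec, ih fun u hu => H u (by simp; omega), H v (by simp)]

theorem proj_eq_iff {n : ℕ} {g h : TreeAut} :
    proj n g = proj n h ↔ ∀ w : List Bool, w.length ≤ n → g w = h w := by
  refine ⟨fun e w hw => ?_, fun H => ?_⟩
  · exact congrArg Subtype.val (DFunLike.congr_fun e (⟨w, hw⟩ : FinWord n))
  · ext1 v
    exact Subtype.ext (H v.1 v.2)

theorem proj_eq_iff_act {n : ℕ} {g h : TreeAut} :
    proj n g = proj n h ↔ ∀ w : List Bool, w.length < n → act g w = act h w := by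
  rw [proj_eq_iff]
  refine ⟨fun H w hw => ?_, fun H w hw => apply_eq_of_act_eq w fun v hv => H v (by omega)⟩
  refine act_unique (x := false) ?_
  rw [H _ (by simp; omega), H _ hw.le, act_spec]

theorem treeAut_ext {g h : TreeAut} (H : ∀ w, act g w = act h w) : g = h := by
  ext1 w
  exact apply_eq_of_act_eq w fun v _ => H v

/-- The action on words of the automorphism with portrait `f`. -/
def portraitFun : (List Bool → ZMod 2) → List Bool → List Bool
  | _, [] => []
  | f, x :: w => flip (f []) x :: portraitFun (fun v => f (x :: v)) w

/-- The inverse of `portraitFun`. -/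
def portraitInv : (List Bool → ZMod 2) → List Bool → List Bool
  | _, [] => []
  | f, y :: w => flip (f []) y :: portraitInv (fun v => f (flip (f []) y :: v)) w

theorem portraitInv_portraitFun (f : List Bool → ZMod 2) (w : List Bool) :
    portraitInv f (portraitFun f w) = w := by
  induction w generalizing f with
  | nil => rfl
  | cons x w ih =>
    rw [portraitFun, portraitInv, flip_flip_self, ih]

theorem portraitFun_portraitInv (f : List Bool → ZMod 2) (w : List Bool) :
    portraitFun f (portraitInv f w) = w := by
  induction w generalizing f with
  | nil => rfl
  | cons x w ih =>
    rw [portraitInv, portraitFun, flip_flip_self, ih]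

theorem portraitFun_snoc (f : List Bool → ZMod 2) (w : List Bool) (x : Bool) :
    portraitFun f (w ++ [x]) = portraitFun f w ++ [flip (f w) x] := by
  induction w generalizing f with
  | nil => rfl
  | cons y w ih =>
    simp [portraitFun, ih]

/-- The automorphism with portrait `f`. -/
def ofPortrait (f : List Bool → ZMod 2) : TreeAut where
  toFun := portraitFun f
  invFun := portraitInv f
  left_inv := portraitInv_portraitFun f
  right_inv := portraitFun_portraitInv f
  map_rel_iff' := by
    intro a b
    show Edge (portraitFun f a) (portraitFun f b) ↔ Edge a b
    constructor
    · rintro ⟨y, hy⟩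
      refine ⟨flip (f a) y, ?_⟩
      rw [← portraitInv_portraitFun f b, hy, ← portraitInv_portraitFun f (a ++ [_]),
        portraitFun_snoc, flip_flip_self]
    · rintro ⟨x, rfl⟩
      exact ⟨_, portraitFun_snoc f a x⟩

@[simp] theorem act_ofPortrait (f : List Bool → ZMod 2) (w : List Bool) :
    act (ofPortrait f) w = f w :=
  act_unique (x := false) (portraitFun_snoc f w false)

theorem treeSection_append (g : TreeAut) (w v : List Bool) :
    treeSection g (w ++ v) = treeSection (treeSection g w) v :=
  treeAut_ext fun u => by simp only [act_treeSection, List.append_assoc]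

@[simp] theorem treeSection_nil (g : TreeAut) : treeSection g [] = g :=
  treeAut_ext fun u => by simp only [act_treeSection, List.nil_append]

theorem apply_singleton (g : TreeAut) (x : Bool) : g [x] = [flip (act g []) x] := by
  have := act_spec g [] x
  rwa [treeAut_nil] at this

theorem apply_cons (g : TreeAut) (x : Bool) (w : List Bool) :
    g (x :: w) = flip (act g []) x :: treeSection g [x] w := by
  have := treeSection_spec g [x] w
  rwa [apply_singleton] at this

/-- The automorphism with activity `a` at the root and sections `g x` at the letters `x`. -/
noncomputable def ofSections (a : ZMod 2) (g : Bool → TreeAut) : TreeAut :=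
  ofPortrait fun w => match w with
    | [] => a
    | x :: v => act (g x) v

@[simp] theorem act_ofSections_nil (a : ZMod 2) (g : Bool → TreeAut) :
    act (ofSections a g) [] = a := by rw [ofSections, act_ofPortrait]

@[simp] theorem act_ofSections_cons (a : ZMod 2) (g : Bool → TreeAut) (x : Bool)
    (w : List Bool) : act (ofSections a g) (x :: w) = act (g x) w := by
  rw [ofSections, act_ofPortrait]

@[simp] theorem treeSection_ofSections (a : ZMod 2) (g : Bool → TreeAut) (x : Bool) :
    treeSection (ofSections a g) [x] = g x :=
  treeAut_ext fun u => by simp [act_treeSection]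

theorem treeAut_ext_sections {g h : TreeAut} (h0 : act g [] = act h [])
    (H : ∀ x, treeSection g [x] = treeSection h [x]) : g = h := by
  refine treeAut_ext fun w => ?_
  rcases w with _ | ⟨x, w⟩
  · exact h0
  · have := congrArg (fun k => act k w) (H x)
    simpa [act_treeSection] using this

theorem treeSection_mul_singleton (g h : TreeAut) (x : Bool) :
    treeSection (g * h) [x] = treeSection g [flip (act h []) x] * treeSection h [x] := by
  rw [treeSection_mul, apply_singleton]

/-- Equal sections at both letters keep the element an involution. Transitivity on levels serves
conjugation arguments; order two serves the swap in `levelGroup_eq_square_sumZero`. -/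
theorem exists_involution_apply_eq {u v : List Bool} (h : u.length = v.length) :
    ∃ g : TreeAut, g u = v ∧ g * g = 1 := by
  induction u generalizing v with
  | nil =>
    obtain rfl : v = [] := List.eq_nil_of_length_eq_zero h.symm
    exact ⟨1, rfl, one_mul 1⟩
  | cons x u ih =>
    obtain _ | ⟨y, v⟩ := v
    · simp at h
    obtain ⟨k, hk, hk2⟩ := ih (by simpa using h : u.length = v.length)
    obtain ⟨a, ha⟩ := exists_flip_eq x y
    refine ⟨ofSections a fun _ => k, ?_, treeAut_ext_sections ?_ fun z => ?_⟩
    · rw [apply_cons, treeSection_ofSections, act_ofSections_nil, hk, ha]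
    · rw [act_mul, treeAut_nil, add_self_zmod_two, act_one]
    · rw [treeSection_mul_singleton, treeSection_ofSections, treeSection_ofSections, hk2,
        treeSection_one]

/-! ### Level stabilizers and level portraits -/

/-- The stabilizer of level `n`. -/
abbrev levelStab (n : ℕ) : Subgroup TreeAut := (proj n).ker

theorem mem_levelStab {n : ℕ} {g : TreeAut} :
    g ∈ levelStab n ↔ ∀ w : List Bool, w.length < n → act g w = 0 := by
  rw [MonoidHom.mem_ker, ← map_one (proj n), proj_eq_iff_act]
  simp

theorem apply_of_mem_levelStab {n : ℕ} {g : TreeAut} (hg : g ∈ levelStab n) {w : List Bool}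
    (hw : w.length ≤ n) : g w = w := by
  rw [MonoidHom.mem_ker, ← map_one (proj n), proj_eq_iff] at hg
  exact hg w hw

theorem levelStab_anti {m n : ℕ} (h : m ≤ n) : levelStab n ≤ levelStab m := fun g hg => by
  rw [mem_levelStab] at *
  exact fun w hw => hg w (by omega)

/-- Functions from the words of length `n` to the field with two elements. -/
abbrev LevelFun (n : ℕ) : Type := List.Vector Bool n → ZMod 2

/-- The activities of `g` on level `n`. -/
noncomputable def level (n : ℕ) (g : TreeAut) : LevelFun n := fun w => act g w.1

theorem level_mul {n : ℕ} (g : TreeAut) {h : TreeAut} (hh : h ∈ levelStab n) :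
    level n (g * h) = level n g + level n h := by
  funext w
  simp only [level, Pi.add_apply, act_mul, apply_of_mem_levelStab hh w.2.le]

theorem level_one (n : ℕ) : level n 1 = 0 := by
  funext w; simp [level]

theorem proj_succ_eq_iff {n : ℕ} {g h : TreeAut} :
    proj (n + 1) g = proj (n + 1) h ↔ proj n g = proj n h ∧ level n g = level n h := by
  simp only [proj_eq_iff_act]
  constructor
  · intro H
    exact ⟨fun w hw => H w (by omega), funext fun w => H w.1 (by have := w.2; omega)⟩
  · rintro ⟨H1, H2⟩ w hw
    rcases Nat.lt_succ_iff_lt_or_eq.1 hw with h | h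
    · exact H1 w h
    · exact congrFun H2 ⟨w, h⟩

/-- The automorphism with activities `f` on level `n` and no others. -/
noncomputable def ofLevel (n : ℕ) (f : LevelFun n) : TreeAut :=
  ofPortrait fun w => if h : w.length = n then f ⟨w, h⟩ else 0

theorem ofLevel_mem (n : ℕ) (f : LevelFun n) : ofLevel n f ∈ levelStab n :=
  mem_levelStab.2 fun w hw => by rw [ofLevel, act_ofPortrait, dif_neg hw.ne]

@[simp] theorem level_ofLevel (n : ℕ) (f : LevelFun n) : level n (ofLevel n f) = f := by
  funext w
  rw [level, ofLevel, act_ofPortrait, dif_pos w.2]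
  rfl

theorem treeSection_mem_levelStab {n : ℕ} {g : TreeAut} (hg : g ∈ levelStab (n + 1))
    (x : Bool) : treeSection g [x] ∈ levelStab n :=
  mem_levelStab.2 fun w hw => by
    rw [act_treeSection]
    exact mem_levelStab.1 hg _ (by simpa using hw)

/-- The permutation of the words of length `n` induced by `g`. -/
def levelPerm (n : ℕ) (g : TreeAut) : Equiv.Perm (List.Vector Bool n) where
  toFun w := ⟨g w.1, (length_treeAut g w.1).trans w.2⟩
  invFun w := ⟨g⁻¹ w.1, (length_treeAut g⁻¹ w.1).trans w.2⟩
  left_inv w := Subtype.ext (g.symm_apply_apply w.1)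
  right_inv w := Subtype.ext (g.apply_symm_apply w.1)

theorem level_mul_perm (n : ℕ) (g h : TreeAut) :
    level n (g * h) = level n g ∘ levelPerm n h + level n h :=
  funext fun w => act_mul g h w.1

theorem level_conj {n : ℕ} (g : TreeAut) {k : TreeAut} (hk : k ∈ levelStab n) :
    level n (g * k * g⁻¹) = level n k ∘ levelPerm n g⁻¹ := by
  have h := level_mul_perm n g g⁻¹
  rw [mul_inv_cancel, level_one] at h
  rw [level_mul_perm, level_mul g hk]
  funext w
  have hw := congrFun h w
  simp only [Pi.add_apply, Function.comp_apply, Pi.zero_apply] at hw ⊢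
  linear_combination -hw

/-- The sum of the activities of `g` on level `n`. -/
noncomputable def levelSum (n : ℕ) (g : TreeAut) : ZMod 2 :=
  ∑ w : List.Vector Bool n, act g w.1

theorem levelSum_eq (n : ℕ) (g : TreeAut) : levelSum n g = ∑ w, level n g w := rfl

/-- The product rule only permutes the arguments of the portrait of `g`, which a sum over the level
does not see. -/
theorem levelSum_mul (n : ℕ) (g h : TreeAut) :
    levelSum n (g * h) = levelSum n g + levelSum n h := by
  simp only [levelSum_eq, level_mul_perm, Pi.add_apply, Finset.sum_add_distrib,
    Function.comp_apply]
  rw [Equiv.sum_comp (levelPerm n h) (level n g)]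

theorem levelSum_one (n : ℕ) : levelSum n 1 = 0 := by simp [levelSum]

theorem levelSum_inv (n : ℕ) (g : TreeAut) : levelSum n g⁻¹ = levelSum n g := by
  have h := levelSum_mul n g g⁻¹
  rw [mul_inv_cancel, levelSum_one] at h
  exact (CharTwo.add_eq_zero.1 h.symm).symm

theorem levelSum_congr {n : ℕ} {g h : TreeAut} (e : proj (n + 1) g = proj (n + 1) h) :
    levelSum n g = levelSum n h := by
  rw [levelSum_eq, (proj_succ_eq_iff.1 e).2, levelSum_eq]

/-- A homomorphism from `Aut(X^*)` to the group with two elements that is trivial on the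
stabilizer of level `n` is a combination of the level sums. -/
theorem exists_levelSum_combination (n : ℕ) (f : TreeAut → ZMod 2)
    (hmul : ∀ g h, f (g * h) = f g + f h) (hf : ∀ g ∈ levelStab n, f g = 0) :
    ∃ a : Fin n → ZMod 2, ∀ g, f g = ∑ i, a i * levelSum i g := by
  induction n generalizing f with
  | zero =>
    refine ⟨fun _ => 0, fun g => ?_⟩
    rw [hf g (mem_levelStab.2 fun w hw => absurd hw (by omega))]
    simp
  | succ n ih =>
    have hone : f 1 = 0 := by simpa using hmul 1 1
    have hcongr : ∀ g h, proj (n + 1) g = proj (n + 1) h → f g = f h := by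
      intro g h e
      have h1 : f (g * h⁻¹) = 0 := hf _ (by
        rw [MonoidHom.mem_ker, map_mul, map_inv, e, mul_inv_cancel])
      have h2 := hmul (g * h⁻¹) h
      rwa [inv_mul_cancel_right, h1, zero_add] at h2
    have hstab : ∀ g ∈ levelStab n, ∀ h ∈ levelStab n, level n g = level n h → f g = f h := by
      intro g hg h hh e
      exact hcongr g h (proj_succ_eq_iff.2 ⟨hg.trans hh.symm, e⟩)
    let L : LevelFun n →+ ZMod 2 :=
      { toFun := fun v => f (ofLevel n v)
        map_zero' := by
          show f (ofLevel n 0) = 0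
          rw [hstab _ (ofLevel_mem n 0) 1 (one_mem _) (by rw [level_ofLevel, level_one]), hone]
        map_add' := fun v w => by
          show f _ = f _ + f _
          rw [← hmul]
          refine hstab _ (ofLevel_mem _ _) _ (mul_mem (ofLevel_mem _ _) (ofLevel_mem _ _)) ?_
          rw [level_mul _ (ofLevel_mem _ _)]
          simp only [level_ofLevel] }
    have hL : ∀ g ∈ levelStab n, f g = L (level n g) := fun g hg =>
      hstab _ hg _ (ofLevel_mem _ _) (by rw [level_ofLevel])
    let u₀ : List.Vector Bool n := List.Vector.replicate n false
    -- `f` is invariant under conjugation and the tree group is transitive on level `n`, so `L`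
    -- takes one value on all basis vectors and is a multiple of the sum.
    have hconst : ∀ u, L (Pi.single u 1) = L (Pi.single u₀ 1) := by
      intro u
      obtain ⟨g, hg⟩ : ∃ g : TreeAut, g u₀.1 = u.1 :=
        (exists_involution_apply_eq (u₀.2.trans u.2.symm)).imp fun _ h => h.1
      have h1 : f (g * ofLevel n (Pi.single u₀ 1) * g⁻¹) = f (ofLevel n (Pi.single u₀ 1)) := by
        have h2 := hmul g g⁻¹
        rw [mul_inv_cancel, hone] at h2
        rw [hmul, hmul]
        linear_combination -h2
      have h3 : g * ofLevel n (Pi.single u₀ 1) * g⁻¹ ∈ levelStab n :=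
        (inferInstance : (levelStab n).Normal).conj_mem _ (ofLevel_mem _ _) g
      rw [show L (Pi.single u₀ 1) = f (ofLevel n (Pi.single u₀ 1)) from rfl, ← h1, hL _ h3]
      congr 1
      rw [level_conj _ (ofLevel_mem _ _), level_ofLevel]
      funext w
      have : levelPerm n g⁻¹ w = u₀ ↔ w = u := by
        rw [show u = levelPerm n g u₀ from Subtype.ext hg.symm]
        exact (levelPerm n g).symm_apply_eq
      simp only [Function.comp_apply, Pi.single_apply, this]
    have hLsum : ∀ v, L v = L (Pi.single u₀ 1) * ∑ w, v w := by
      intro v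
      conv_lhs => rw [← Finset.univ_sum_single v]
      rw [map_sum, Finset.mul_sum]
      refine Finset.sum_congr rfl fun w _ => ?_
      rcases zmod_two_cases (v w) with h | h
      · rw [h]; simp
      · rw [h, hconst, mul_one]
    -- Subtracting this multiple of the level sum kills the stabilizer of level `n`.
    obtain ⟨a, ha⟩ := ih (fun g => f g - L (Pi.single u₀ 1) * levelSum n g)
      (fun g h => by rw [hmul, levelSum_mul]; ring)
      (fun g hg => by rw [hL g hg, hLsum, levelSum_eq, sub_self])
    refine ⟨Fin.snoc a (L (Pi.single u₀ 1)), fun g => ?_⟩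
    rw [Fin.sum_univ_castSucc]
    simp only [Fin.snoc_castSucc, Fin.snoc_last, Fin.val_castSucc, Fin.val_last]
    rw [← ha g]
    ring


/-! ### Orders of the finite quotients -/

/-- The level `n` portraits of the elements of `H` that fix level `n`. -/
def levelGroup (n : ℕ) (H : Subgroup TreeAut) : AddSubgroup (LevelFun n) where
  carrier := {v | ∃ h ∈ H, h ∈ levelStab n ∧ level n h = v}
  zero_mem' := ⟨1, one_mem _, one_mem _, level_one n⟩
  add_mem' := by
    rintro _ _ ⟨g, hg, hg', rfl⟩ ⟨h, hh, hh', rfl⟩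
    exact ⟨g * h, mul_mem hg hh, mul_mem hg' hh', level_mul g hh'⟩
  neg_mem' := by
    rintro _ ⟨g, hg, hg', rfl⟩
    refine ⟨g, hg, hg', funext fun w => ?_⟩
    rw [Pi.neg_apply, CharTwo.neg_eq]

theorem mem_levelGroup {n : ℕ} {H : Subgroup TreeAut} {v : LevelFun n} :
    v ∈ levelGroup n H ↔ ∃ h ∈ H, h ∈ levelStab n ∧ level n h = v := Iff.rfl

theorem mem_levelStab_succ {n : ℕ} {g : TreeAut} :
    g ∈ levelStab (n + 1) ↔ g ∈ levelStab n ∧ level n g = 0 := by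
  have := proj_succ_eq_iff (n := n) (g := g) (h := 1)
  rwa [map_one, map_one, level_one] at this

/-- On the elements of `H` fixing level `n`, `level n` is a homomorphism with kernel the stabilizer
of level `n + 1` and image the level group. -/
theorem card_map_proj_succ (n : ℕ) (H : Subgroup TreeAut) :
    Nat.card (H.map (proj (n + 1))) = Nat.card (H.map (proj n)) * Nat.card (levelGroup n H) := by
  rw [← Subgroup.relIndex_ker, ← Subgroup.relIndex_ker, mul_comm]
  have h1 := Subgroup.relIndex_inf_mul_relIndex (levelStab (n + 1)) (levelStab n) H
  rw [inf_eq_left.2 (levelStab_anti (Nat.le_succ n))] at h1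
  rw [← h1]
  congr 1
  let f : ↥(levelStab n ⊓ H) →* Multiplicative (LevelFun n) :=
    { toFun := fun g => Multiplicative.ofAdd (level n g.1)
      map_one' := by
        rw [← ofAdd_zero, ← level_one n]
        rfl
      map_mul' := fun g h => by
        rw [← ofAdd_add, ← level_mul g.1 h.2.1]
        rfl }
  have hker : (levelStab (n + 1)).subgroupOf (levelStab n ⊓ H) = f.ker := by
    ext g
    rw [Subgroup.mem_subgroupOf, mem_levelStab_succ]
    exact ⟨fun h => congrArg Multiplicative.ofAdd h.2, fun h => ⟨g.2.1, Multiplicative.ofAdd.injective h⟩⟩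
  rw [Subgroup.relIndex, hker, Subgroup.index_ker]
  refine Nat.card_congr (Multiplicative.toAdd.subtypeEquiv fun v => ?_)
  rw [MonoidHom.mem_range, mem_levelGroup]
  constructor
  · rintro ⟨g, rfl⟩
    exact ⟨g.1, g.2.2, g.2.1, rfl⟩
  · rintro ⟨h, hH, hs, e⟩
    exact ⟨⟨h, hs, hH⟩, congrArg Multiplicative.ofAdd e⟩

theorem card_levelFun (n : ℕ) : Nat.card (LevelFun n) = 2 ^ 2 ^ n := by
  rw [Nat.card_eq_fintype_card, Fintype.card_fun, ZMod.card, card_vector, Fintype.card_bool]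

theorem card_finTreeAut_eq_card_map (n : ℕ) :
    Nat.card (FinTreeAut n) = Nat.card ((⊤ : Subgroup TreeAut).map (proj n)) := by
  rw [← MonoidHom.range_eq_map, MonoidHom.range_eq_top.2 (proj_surjective n)]
  exact (Nat.card_congr Subgroup.topEquiv.toEquiv).symm

theorem card_finTreeAut_succ (n : ℕ) :
    Nat.card (FinTreeAut (n + 1)) = Nat.card (FinTreeAut n) * 2 ^ 2 ^ n := by
  rw [card_finTreeAut_eq_card_map, card_map_proj_succ, ← card_finTreeAut_eq_card_map,
    ← card_levelFun]
  congr 1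
  rw [show levelGroup n ⊤ = ⊤ from eq_top_iff.2 fun v _ =>
    ⟨ofLevel n v, Subgroup.mem_top _, ofLevel_mem n v, level_ofLevel n v⟩]
  exact Nat.card_congr AddSubgroup.topEquiv.toEquiv

theorem card_finTreeAut_strictMono : StrictMono fun n => Nat.card (FinTreeAut n) := by
  refine strictMono_nat_of_lt_succ fun n => ?_
  rw [card_finTreeAut_succ]
  exact lt_mul_of_one_lt_right Nat.card_pos (Nat.one_lt_two_pow (by positivity))

/-- The distance between distinct automorphisms that agree to level `n` and no further. -/
noncomputable def levelDist (n : ℕ) : ℝ := 1 / (Nat.card (FinTreeAut n) : ℝ)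

theorem levelDist_pos (n : ℕ) : 0 < levelDist n := one_div_pos.2 (card_finTreeAut_pos n)

theorem levelDist_strictAnti : StrictAnti levelDist := fun m _ h =>
  one_div_lt_one_div_of_lt (card_finTreeAut_pos m)
    (Nat.cast_lt.2 (card_finTreeAut_strictMono h))

theorem tendsto_levelDist : Filter.Tendsto levelDist Filter.atTop (nhds 0) := by
  have h : Filter.Tendsto (fun n => (Nat.card (FinTreeAut n) : ℝ)) Filter.atTop Filter.atTop :=
    tendsto_natCast_atTop_atTop.comp card_finTreeAut_strictMono.tendsto_atTop
  exact h.const_div_atTop 1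

theorem dist_eq_levelDist {g h : TreeAut} (e : g ≠ h) : dist g h = levelDist (agreeLevel g h) :=
  if_neg e

theorem dist_le_levelDist {n : ℕ} {g h : TreeAut} (e : proj n g = proj n h) :
    dist g h ≤ levelDist n := by
  by_cases hgh : g = h
  · rw [hgh, dist_self]
    exact (levelDist_pos n).le
  · rw [dist_eq_levelDist hgh]
    exact levelDist_strictAnti.antitone (le_agreeLevel hgh e)

theorem proj_eq_of_dist_le {n : ℕ} {g h : TreeAut} (e : dist g h ≤ levelDist n) :
    proj n g = proj n h := by
  by_cases hgh : g = h
  · rw [hgh]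
  · rw [dist_eq_levelDist hgh, levelDist_strictAnti.le_iff_ge] at e
    exact proj_eq_of_le e (proj_agreeLevel g h)

/-! ### The profinite topology -/

theorem eventually_proj_eq (n : ℕ) (g : TreeAut) : ∀ᶠ h in nhds g, proj n h = proj n g := by
  filter_upwards [Metric.ball_mem_nhds g (levelDist_pos n)] with h hh
  exact proj_eq_of_dist_le (Metric.mem_ball.1 hh).le

theorem continuous_of_eventually_proj_eq {X : Type*} [TopologicalSpace X] {f : X → TreeAut}
    (H : ∀ n x, ∀ᶠ y in nhds x, proj n (f y) = proj n (f x)) : Continuous f := by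
  refine continuous_iff_continuousAt.2 fun x => Metric.tendsto_nhds.2 fun ε hε => ?_
  obtain ⟨n, hn⟩ := ((tendsto_order.1 tendsto_levelDist).2 ε hε).exists
  filter_upwards [H n x] with y hy
  exact (dist_le_levelDist hy).trans_lt hn

instance : IsTopologicalGroup TreeAut where
  continuous_mul := continuous_of_eventually_proj_eq fun n x => by
    filter_upwards [(eventually_proj_eq n x.1).prod_nhds (eventually_proj_eq n x.2)] with y hy
    rw [map_mul, map_mul, hy.1, hy.2]
  continuous_inv := continuous_of_eventually_proj_eq fun n x => by
    filter_upwards [eventually_proj_eq n x] with y hy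
    rw [map_inv, map_inv, hy]

/-- The Cantor space of portraits maps continuously onto the group. -/
instance : CompactSpace TreeAut := by
  let F : (List Bool → Bool) → TreeAut := fun f => ofPortrait fun w => if f w then 1 else 0
  have hF : Function.Surjective F := fun g =>
    ⟨fun w => decide (act g w = 1), treeAut_ext fun w => by
      rcases zmod_two_cases (act g w) with h | h <;> simp [F, h]⟩
  refine hF.compactSpace (continuous_of_eventually_proj_eq fun n f => ?_)
  have : ∀ᶠ f' in nhds f, ∀ w ∈ {w : List Bool | w.length < n}, f' w = f w :=
    (Filter.eventually_all_finite (List.finite_length_lt Bool n)).2 fun w _ =>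
      (continuous_apply w).continuousAt (mem_nhds_discrete.2 (Set.mem_singleton (f w)))
  filter_upwards [this] with f' hf'
  refine proj_eq_iff_act.2 fun w hw => ?_
  simp only [F, act_ofPortrait, hf' w hw]

theorem isOpen_levelStab (n : ℕ) : IsOpen (levelStab n : Set TreeAut) :=
  isOpen_iff_mem_nhds.2 fun g hg => by
    filter_upwards [eventually_proj_eq n g] with h hh
    exact hh.trans hg

/-! ### Hausdorff dimension of closed subgroups -/

-- Cover `H` by the cylinders of level `n`: the sums of powers of diameters stay below `C`, so the
-- Hausdorff measure is finite.
open MeasureTheory Filter ENNReal in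
theorem dimH_le_of_card_le {H : Subgroup TreeAut} {s : NNReal} {n₀ : ℕ} {C : ℝ}
    (hC : ∀ n ≥ n₀, (Nat.card (H.map (proj n)) : ℝ) * levelDist n ^ (s : ℝ) ≤ C) :
    dimH (H : Set TreeAut) ≤ s := by
  borelize TreeAut
  refine dimH_le_of_hausdorffMeasure_ne_top (ne_top_of_le_ne_top (b := ENNReal.ofReal C)
    ENNReal.ofReal_ne_top ?_)
  let : ∀ n, Fintype (H.map (proj n)) := fun n => Fintype.ofFinite _
  have hdiam : ∀ (n : ℕ) (p : H.map (proj n)),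
      Metric.ediam {g : TreeAut | proj n g = p} ≤ ENNReal.ofReal (levelDist n) := fun n p =>
    Metric.ediam_le fun g hg h hh => by
      rw [edist_dist]
      exact ENNReal.ofReal_le_ofReal (dist_le_levelDist (hg.trans hh.symm))
  refine (Measure.hausdorffMeasure_le_liminf_sum (l := atTop) (s : ℝ) (H : Set TreeAut)
    (fun n => ENNReal.ofReal (levelDist n)) ?_ (fun n (p : H.map (proj n)) =>
      {g | proj n g = p}) (Eventually.of_forall hdiam) (Eventually.of_forall fun n g hg =>
        Set.mem_iUnion.2 ⟨⟨proj n g, Subgroup.mem_map_of_mem _ hg⟩, rfl⟩)).trans ?_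
  · simpa using ENNReal.tendsto_ofReal tendsto_levelDist
  · refine liminf_le_of_frequently_le' (Eventually.frequently ?_)
    filter_upwards [eventually_ge_atTop n₀] with n hn
    calc ∑ p : H.map (proj n), Metric.ediam {g : TreeAut | proj n g = p} ^ (s : ℝ)
        ≤ ∑ p : H.map (proj n), ENNReal.ofReal (levelDist n) ^ (s : ℝ) :=
          Finset.sum_le_sum fun p _ => ENNReal.rpow_le_rpow (hdiam n p) s.2
      _ = ENNReal.ofReal (Nat.card (H.map (proj n)) * levelDist n ^ (s : ℝ)) := by
          rw [Finset.sum_const, Finset.card_univ, ← Nat.card_eq_fintype_card, nsmul_eq_mul,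
            ENNReal.ofReal_mul (Nat.cast_nonneg _), ENNReal.ofReal_natCast,
            ENNReal.ofReal_rpow_of_pos (levelDist_pos n)]
      _ ≤ ENNReal.ofReal C := ENNReal.ofReal_le_ofReal (hC n hn)

-- Mass distribution principle, with a multiple of Haar measure on the compact group `H` as the
-- mass.
open MeasureTheory Filter ENNReal Pointwise in
theorem le_dimH_of_le_card {H : Subgroup TreeAut} (hH : IsClosed (H : Set TreeAut))
    {s : NNReal} {n₀ : ℕ} {C : ℝ} (hC0 : 0 < C)
    (hC : ∀ n ≥ n₀, C ≤ (Nat.card (H.map (proj n)) : ℝ) * levelDist n ^ (s : ℝ)) :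
    s ≤ dimH (H : Set TreeAut) := by
  rcases eq_or_ne s 0 with rfl | hs
  · simp
  have hdim : dimH (Set.univ : Set H) = dimH (H : Set TreeAut) := by
    rw [← isometry_subtype_coe.dimH_image, Set.image_univ, Subtype.range_coe]
  rw [← hdim]
  have : CompactSpace H := isCompact_iff_compactSpace.1 hH.isCompact
  let _ : MeasurableSpace H := borel H
  have : BorelSpace H := ⟨rfl⟩
  let μ : Measure H := Measure.haar
  have hm0 : μ Set.univ ≠ 0 := (isOpen_univ.measure_pos μ Set.univ_nonempty).ne'
  have hm1 : μ Set.univ ≠ ∞ := measure_ne_top μ _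
  -- Total mass `C` is exactly what makes a coset of the level `n` stabilizer have mass at most
  -- `levelDist n ^ s`.
  let ν : Measure H := (ENNReal.ofReal C / μ Set.univ) • μ
  have key : ∀ n ≥ n₀, ∀ S : Set H, (∀ x ∈ S, ∀ y ∈ S, proj n x.1 = proj n y.1) →
      ν S ≤ ENNReal.ofReal (levelDist n) ^ (s : ℝ) := by
    intro n hn S hS
    rcases S.eq_empty_or_nonempty with rfl | ⟨x, hx⟩
    · simp
    let K : Subgroup H := (levelStab n).subgroupOf H
    have hKo : IsOpen (K : Set H) := (isOpen_levelStab n).preimage continuous_subtype_val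
    have hidx : K.index = Nat.card (H.map (proj n)) := Subgroup.relIndex_ker _ _
    have : K.FiniteIndex := ⟨by rw [hidx]; exact Nat.card_pos.ne'⟩
    have hsub : S ⊆ x • (K : Set H) := fun y hy => by
      rw [Set.mem_smul_set_iff_inv_smul_mem]
      show (x⁻¹ * y : H).1 ∈ levelStab n
      rw [MonoidHom.mem_ker]
      show proj n (x.1⁻¹ * y.1) = 1
      rw [map_mul, map_inv, hS x hx y hy, inv_mul_cancel]
    have hμ : (Nat.card (H.map (proj n)) : ℝ≥0∞) * μ S ≤ μ Set.univ := by
      rw [← K.index_mul_measure hKo.measurableSet μ, hidx, ← measure_smul μ x (K : Set H)]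
      gcongr
    have hc : (Nat.card (H.map (proj n)) : ℝ≥0∞) ≠ 0 := by
      exact_mod_cast (Nat.card_pos (α := H.map (proj n))).ne'
    have h1 : ENNReal.ofReal C ≤
        Nat.card (H.map (proj n)) * ENNReal.ofReal (levelDist n) ^ (s : ℝ) := by
      rw [ENNReal.ofReal_rpow_of_pos (levelDist_pos n), ← ENNReal.ofReal_natCast,
        ← ENNReal.ofReal_mul (Nat.cast_nonneg _)]
      exact ENNReal.ofReal_le_ofReal (hC n hn)
    show ENNReal.ofReal C / μ Set.univ * μ S ≤ _
    calc ENNReal.ofReal C / μ Set.univ * μ S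
        ≤ (Nat.card (H.map (proj n)) * ENNReal.ofReal (levelDist n) ^ (s : ℝ)) /
            μ Set.univ * μ S := by gcongr
      _ = ENNReal.ofReal (levelDist n) ^ (s : ℝ) *
            ((Nat.card (H.map (proj n)) * μ S) / μ Set.univ) := by
          simp only [div_eq_mul_inv]; ring
      _ ≤ ENNReal.ofReal (levelDist n) ^ (s : ℝ) * 1 := by
          gcongr
          exact ENNReal.div_le_of_le_mul (by rwa [one_mul])
      _ = _ := mul_one _
  have hle : ν ≤ Measure.hausdorffMeasure (s : ℝ) := by
    refine Measure.le_hausdorffMeasure _ _ (ENNReal.ofReal (levelDist n₀))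
      (ENNReal.ofReal_pos.2 (levelDist_pos _)) fun S hS => ?_
    -- A point has diameter zero, so no single level matches it; all levels are used, and `s ≠ 0`
    -- makes the bounds tend to zero.
    by_cases hsub : S.Subsingleton
    · have hlim : Tendsto (fun n => ENNReal.ofReal (levelDist n) ^ (s : ℝ)) atTop (nhds 0) := by
        have h1 := ENNReal.tendsto_ofReal tendsto_levelDist
        have h2 := ((ENNReal.continuous_rpow_const (y := (s : ℝ))).tendsto _).comp h1
        rw [ENNReal.ofReal_zero, ENNReal.zero_rpow_of_pos (NNReal.coe_pos.2 (pos_of_ne_zero hs))]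
          at h2
        exact h2
      have h0 : ν S ≤ 0 := ge_of_tendsto hlim (by
        filter_upwards [eventually_ge_atTop n₀] with n hn
        exact key n hn S fun x hx y hy => by rw [hsub hx hy])
      exact h0.trans bot_le
    · obtain ⟨x, hx, y, hy, hxy⟩ := Set.not_subsingleton_iff.1 hsub
      -- The least agreement level is attained by a pair, whose distance bounds the diameter below,
      -- while all of `S` agrees up to that level.
      let A : Set ℕ := {n | ∃ x ∈ S, ∃ y ∈ S, x ≠ y ∧ agreeLevel x.1 y.1 = n}
      have hA : A.Nonempty := ⟨_, x, hx, y, hy, hxy, rfl⟩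
      obtain ⟨a, ha, b, hb, hab, hn⟩ := Nat.sInf_mem hA
      have hd : ENNReal.ofReal (levelDist (sInf A)) ≤ Metric.ediam S := by
        rw [← hn, ← dist_eq_levelDist (Subtype.coe_injective.ne hab), ← edist_dist]
        exact Metric.edist_le_ediam_of_mem ha hb
      have hn₀ : n₀ ≤ sInf A := by
        have := (ENNReal.ofReal_le_ofReal_iff (levelDist_pos _).le).1 (hd.trans hS)
        rwa [levelDist_strictAnti.le_iff_ge] at this
      refine (key _ hn₀ S fun u hu v hv => ?_).trans (ENNReal.rpow_le_rpow hd s.2)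
      by_cases huv : u = v
      · rw [huv]
      · exact proj_eq_of_le (Nat.sInf_le (show agreeLevel u.1 v.1 ∈ A from
          ⟨u, hu, v, hv, huv, rfl⟩)) (proj_agreeLevel _ _)
  refine le_dimH_of_hausdorffMeasure_ne_zero fun h0 => ?_
  have h1 : ν Set.univ ≤ 0 := h0 ▸ hle Set.univ
  have h2 : ν Set.univ = ENNReal.ofReal C := ENNReal.div_mul_cancel hm0 hm1
  rw [h2] at h1
  exact absurd h1 (not_le.2 (ENNReal.ofReal_pos.2 hC0))

theorem dimH_eq_of_card_eq {H : Subgroup TreeAut} (hH : IsClosed (H : Set TreeAut))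
    {s : NNReal} {n₀ : ℕ} {C : ℝ} (hC0 : 0 < C)
    (hC : ∀ n ≥ n₀, (Nat.card (H.map (proj n)) : ℝ) * levelDist n ^ (s : ℝ) = C) :
    dimH (H : Set TreeAut) = s :=
  le_antisymm (dimH_le_of_card_le fun n hn => (hC n hn).le)
    (le_dimH_of_le_card hH hC0 fun n hn => (hC n hn).ge)


/-! ### Finitely constrained groups as self-similar groups of finite type -/

/-- `H` contains the sections of its elements. -/
def IsSelfSimilar (H : Subgroup TreeAut) : Prop :=
  ∀ g ∈ H, ∀ w : List Bool, treeSection g w ∈ H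

/-- Membership in `H` is decided by the patterns of size `d` of an automorphism. -/
def IsOfFiniteType (H : Subgroup TreeAut) (d : ℕ) : Prop :=
  ∀ g : TreeAut, (∀ w, ∃ h ∈ H, proj d (treeSection g w) = proj d h) → g ∈ H

/-- This removes the pattern group from the problem: the size `d` patterns of `H` itself form one,
essential because `H` contains its sections. -/
theorem hasPatternsOfSize_iff {H : Subgroup TreeAut} {d : ℕ} :
    HasPatternsOfSize H d ↔ 1 ≤ d ∧ IsSelfSimilar H ∧ IsOfFiniteType H d := by
  constructor
  · rintro ⟨k, P, rfl, -, rfl⟩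
    refine ⟨by omega, fun g hg w v => ?_, fun g hg w => ?_⟩
    · rw [← treeSection_append]
      exact hg _
    · obtain ⟨h, hh, e⟩ := hg w
      rw [e, ← treeSection_nil h]
      exact hh []
  · rintro ⟨hd, hs, hf⟩
    obtain ⟨k, rfl⟩ := Nat.exists_eq_add_of_le' hd
    refine ⟨k, H.map (proj (k + 1)), rfl, ?_, ?_⟩
    · rintro _ ⟨g, hg, rfl⟩ x
      exact ⟨proj (k + 1) (treeSection g [x]), ⟨_, hs g hg _, rfl⟩, rfl⟩
    · ext g
      refine ⟨fun hg w => ⟨_, hs g hg w, rfl⟩, fun hg => hf g fun w => ?_⟩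
      obtain ⟨h, hh, e⟩ := hg w
      exact ⟨h, hh, e.symm⟩

theorem proj_treeSection_eq {n : ℕ} {g h : TreeAut} {w : List Bool}
    (e : proj (w.length + n) g = proj (w.length + n) h) :
    proj n (treeSection g w) = proj n (treeSection h w) := by
  rw [proj_eq_iff_act] at *
  intro v hv
  rw [act_treeSection, act_treeSection]
  exact e _ (by rw [List.length_append]; omega)

theorem proj_treeSection_singleton_eq {n : ℕ} {g h : TreeAut} (x : Bool)
    (e : proj (n + 1) g = proj (n + 1) h) :
    proj n (treeSection g [x]) = proj n (treeSection h [x]) :=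
  proj_treeSection_eq (w := [x]) (by rwa [List.length_singleton, Nat.add_comm])

/-- Non-membership is witnessed by one forbidden pattern at some `w`, hence visible at level
`w.length + d`. -/
theorem IsOfFiniteType.isClosed {H : Subgroup TreeAut} {d : ℕ} (hs : IsSelfSimilar H)
    (hf : IsOfFiniteType H d) : IsClosed (H : Set TreeAut) := by
  rw [← isOpen_compl_iff, isOpen_iff_mem_nhds]
  intro g hg
  obtain ⟨w, hw⟩ : ∃ w, ∀ h ∈ H, proj d (treeSection g w) ≠ proj d h := by
    by_contra! hc
    exact hg (hf g hc)
  filter_upwards [eventually_proj_eq (w.length + d) g] with h hh hH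
  exact hw _ (hs h hH w) (proj_treeSection_eq hh).symm

/-! ### Level portraits of self-similar groups of finite type -/

/-- The restriction of a function on level `n + 1` to the words that start with `x`. -/
def half {n : ℕ} (x : Bool) (v : LevelFun (n + 1)) : LevelFun n := fun u => v (x ::ᵥ u)

theorem level_treeSection (n : ℕ) (g : TreeAut) (x : Bool) :
    level n (treeSection g [x]) = half x (level (n + 1) g) :=
  funext fun u => act_treeSection g [x] u.1

/-- The functions on level `n + 1` both of whose halves lie in `W`. -/
def square {n : ℕ} (W : AddSubgroup (LevelFun n)) : AddSubgroup (LevelFun (n + 1)) where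
  carrier := {v | ∀ x, half x v ∈ W}
  zero_mem' _ := W.zero_mem
  add_mem' hv hw x := W.add_mem (hv x) (hw x)
  neg_mem' hv x := W.neg_mem (hv x)

/-- The function on level `n + 1` with given halves. -/
def ofHalves {n : ℕ} (f : Bool → LevelFun n) : LevelFun (n + 1) := fun w => f w.head w.tail

theorem half_ofHalves {n : ℕ} (f : Bool → LevelFun n) (x : Bool) : half x (ofHalves f) = f x :=
  rfl

theorem ofHalves_half {n : ℕ} (v : LevelFun (n + 1)) : ofHalves (fun x => half x v) = v :=
  funext fun w => congrArg v (List.Vector.cons_head_tail w)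

theorem card_square {n : ℕ} (W : AddSubgroup (LevelFun n)) :
    Nat.card (square W) = Nat.card W ^ 2 := by
  let e : square W ≃ (Bool → W) :=
    { toFun := fun v x => ⟨half x v.1, v.2 x⟩
      invFun := fun f => ⟨ofHalves fun x => (f x).1, fun x => (f x).2⟩
      left_inv := fun v => Subtype.ext (ofHalves_half v.1)
      right_inv := fun f => rfl }
  rw [Nat.card_congr e, Nat.card_fun, Nat.card_eq_fintype_card (α := Bool),
    Fintype.card_bool]

theorem levelGroup_succ_le {H : Subgroup TreeAut} (hs : IsSelfSimilar H) (n : ℕ) :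
    levelGroup (n + 1) H ≤ square (levelGroup n H) := by
  rintro _ ⟨h, hh, hl, rfl⟩ x
  exact ⟨_, hs h hh [x], treeSection_mem_levelStab hl x, level_treeSection n h x⟩

/-- Glue elements of `H` realizing the two halves under an inactive root. Since `d ≤ n + 1` the
pattern at the root is trivial, and every pattern below it occurs in `H`. -/
theorem levelGroup_succ_eq {H : Subgroup TreeAut} {d n : ℕ} (hs : IsSelfSimilar H)
    (hf : IsOfFiniteType H d) (hd : d ≤ n + 1) :
    levelGroup (n + 1) H = square (levelGroup n H) := by
  refine le_antisymm (levelGroup_succ_le hs n) fun v hv => ?_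
  choose h hh hl hlv using hv
  have hmem : ofSections 0 h ∈ levelStab (n + 1) := mem_levelStab.2 fun w hw => by
    rcases w with _ | ⟨x, w⟩
    · rw [act_ofSections_nil]
    · rw [act_ofSections_cons]
      exact mem_levelStab.1 (hl x) w (by simpa using hw)
  refine ⟨ofSections 0 h, hf _ fun w => ?_, hmem, ?_⟩
  · rcases w with _ | ⟨x, w⟩
    · refine ⟨1, one_mem _, ?_⟩
      rw [treeSection_nil, map_one]
      exact levelStab_anti hd hmem
    · refine ⟨treeSection (h x) w, hs _ (hh x) w, ?_⟩
      rw [← List.singleton_append, treeSection_append, treeSection_ofSections]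
  · rw [← ofHalves_half (level (n + 1) (ofSections 0 h)), ← ofHalves_half v]
    congr 1
    funext x
    rw [← level_treeSection, treeSection_ofSections, hlv]

theorem card_levelGroup_add {H : Subgroup TreeAut} {m : ℕ} (hs : IsSelfSimilar H)
    (hf : IsOfFiniteType H (m + 1)) (j : ℕ) :
    Nat.card (levelGroup (m + j) H) = Nat.card (levelGroup m H) ^ 2 ^ j := by
  induction j with
  | zero => simp
  | succ j ih =>
    rw [← Nat.add_assoc, levelGroup_succ_eq hs hf (by omega), card_square, ih, ← pow_mul,
      pow_succ]

/-- With `s` the claimed dimension, the level group at `n ≥ m` has order `(2 ^ 2 ^ n) ^ s`. So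
passing to the next level multiplies the order of the image of `H` by the inverse of the factor on
`levelDist n ^ s`, and their product is constant. -/
theorem hausdorffDim_eq {H : Subgroup TreeAut} {m : ℕ} (hs : IsSelfSimilar H)
    (hf : IsOfFiniteType H (m + 1)) :
    hausdorffDim H =
      ENNReal.ofReal (Real.logb 2 (Nat.card (levelGroup m H)) / 2 ^ m) := by
  have hk : (1 : ℝ) ≤ Nat.card (levelGroup m H) := by exact_mod_cast Nat.card_pos
  have hs0 : 0 ≤ Real.logb 2 (Nat.card (levelGroup m H)) / 2 ^ m :=
    div_nonneg (Real.logb_nonneg one_lt_two hk) (by positivity)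
  set s := Real.logb 2 (Nat.card (levelGroup m H)) / 2 ^ m with hs_def
  have hcard : ∀ n ≥ m, (Nat.card (levelGroup n H) : ℝ) = ((2 : ℝ) ^ 2 ^ n) ^ s := by
    intro n hn
    obtain ⟨j, rfl⟩ := Nat.exists_eq_add_of_le hn
    rw [card_levelGroup_add hs hf, ← Real.rpow_natCast, ← Real.rpow_mul zero_le_two, Nat.cast_pow]
    have : ((2 ^ (m + j) : ℕ) : ℝ) * s =
        Real.logb 2 (Nat.card (levelGroup m H)) * (2 ^ j : ℕ) := by
      rw [hs_def]
      push_cast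
      field_simp
      ring
    rw [this, Real.rpow_mul zero_le_two, Real.rpow_logb two_pos (by norm_num) (by linarith),
      Real.rpow_natCast]
  have hpos : (0 : ℝ) < Nat.card (H.map (proj m)) * levelDist m ^ s :=
    mul_pos (Nat.cast_pos.2 Nat.card_pos) (Real.rpow_pos_of_pos (levelDist_pos m) s)
  refine dimH_eq_of_card_eq (hf.isClosed hs) (n₀ := m) hpos fun n hn => ?_
  rw [Real.coe_toNNReal _ hs0]
  induction n, hn using Nat.le_induction with
  | base => rfl
  | succ n hn ih =>
    rw [← ih, card_map_proj_succ, Nat.cast_mul, hcard n hn, levelDist, levelDist,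
      card_finTreeAut_succ, Nat.cast_mul, Nat.cast_pow, Nat.cast_ofNat, ← one_div_mul_one_div,
      Real.mul_rpow (by positivity) (by positivity), mul_assoc]
    congr 1
    rw [mul_left_comm, ← Real.mul_rpow (by positivity) (by positivity)]
    simp

/-! ### The dimension condition as index four, and reduction of the pattern size -/

theorem hausdorffDim_eq_iff {H : Subgroup TreeAut} {n : ℕ} (hs : IsSelfSimilar H)
    (hf : IsOfFiniteType H (n + 2)) :
    hausdorffDim H = ENNReal.ofReal (1 - 2 / 2 ^ (n + 1)) ↔
      4 * Nat.card (levelGroup (n + 1) H) = 2 ^ 2 ^ (n + 1) := by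
  have hk : (1 : ℝ) ≤ Nat.card (levelGroup (n + 1) H) := by exact_mod_cast Nat.card_pos
  have h2 : (2 : ℝ) ≤ 2 ^ (n + 1) := by
    simpa using pow_le_pow_right₀ (one_le_two (α := ℝ)) (Nat.le_add_left 1 n)
  rw [hausdorffDim_eq hs hf, ENNReal.ofReal_eq_ofReal_iff
    (div_nonneg (Real.logb_nonneg one_lt_two hk) (by positivity))
    (sub_nonneg.2 ((div_le_one (by positivity)).2 h2)), one_sub_div (by positivity),
    div_left_inj' (by positivity), Real.logb_eq_iff_rpow_eq two_pos (by norm_num) (by linarith),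
    Real.rpow_sub two_pos, div_eq_iff (by positivity)]
  rw [show ((2 : ℝ) ^ (2 : ℝ)) = 4 by norm_num,
    show ((2 : ℝ) ^ (n + 1)) = ((2 ^ (n + 1) : ℕ) : ℝ) by push_cast; rfl, Real.rpow_natCast,
    eq_comm, mul_comm]
  exact_mod_cast Iff.rfl

theorem exists_mem_proj_succ_eq {H : Subgroup TreeAut} {m : ℕ} {g h : TreeAut} (hh : h ∈ H)
    (e : proj m g = proj m h) (hl : level m (g * h⁻¹) ∈ levelGroup m H) :
    ∃ h' ∈ H, proj (m + 1) g = proj (m + 1) h' := by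
  obtain ⟨k, hk, hks, hkl⟩ := hl
  have hg : g * h⁻¹ ∈ levelStab m := by
    rw [MonoidHom.mem_ker, map_mul, map_inv, e, mul_inv_cancel]
  have : proj (m + 1) (g * h⁻¹) = proj (m + 1) k :=
    proj_succ_eq_iff.2 ⟨hg.trans hks.symm, hkl.symm⟩
  refine ⟨k * h, mul_mem hk hh, ?_⟩
  rw [map_mul, ← this, ← map_mul, inv_mul_cancel_right]

/-- If the last level adds no condition beyond those on the two halves, it follows from the patterns
of size `n + 1` at the children. -/
theorem IsOfFiniteType.of_levelGroup_eq {H : Subgroup TreeAut} {n : ℕ} (hs : IsSelfSimilar H)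
    (hf : IsOfFiniteType H (n + 2)) (hW : levelGroup (n + 1) H = square (levelGroup n H)) :
    IsOfFiniteType H (n + 1) := by
  intro g hg
  refine hf g fun w => ?_
  obtain ⟨h, hh, e⟩ := hg w
  refine exists_mem_proj_succ_eq hh e ?_
  rw [hW]
  intro x
  rw [← level_treeSection]
  have hmem : treeSection g w * h⁻¹ ∈ levelStab (n + 1) := by
    rw [MonoidHom.mem_ker, map_mul, map_inv, e, mul_inv_cancel]
  -- In the product `h⁻¹` moves `x` first, so the relevant section of `g` sits below `w` at `h⁻¹
  -- [x]`.
  obtain ⟨k, hk, ek⟩ := hg (w ++ h⁻¹ [x])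
  have hsec : treeSection (treeSection g w * h⁻¹) [x] =
      treeSection g (w ++ h⁻¹ [x]) * treeSection h⁻¹ [x] := by
    rw [treeSection_mul, treeSection_append]
  refine ⟨k * treeSection h⁻¹ [x], mul_mem hk (hs _ (inv_mem hh) _), ?_, ?_⟩
  · have h1 := treeSection_mem_levelStab hmem x
    rw [hsec, MonoidHom.mem_ker, map_mul, proj_eq_of_le (Nat.le_succ n) ek, ← map_mul] at h1
    exact h1
  · refine (proj_succ_eq_iff.1 ?_).2
    rw [hsec, map_mul, map_mul, ek]

/-- A proper level group has index at least two, so its square has index at least four, leaving no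
room below it. -/
theorem levelGroup_succ_eq_of_card {H : Subgroup TreeAut} {n : ℕ} (hs : IsSelfSimilar H)
    (hc : 4 * Nat.card (levelGroup (n + 1) H) = 2 ^ 2 ^ (n + 1)) (hn : levelGroup n H ≠ ⊤) :
    levelGroup (n + 1) H = square (levelGroup n H) := by
  have h1 := AddSubgroup.card_mul_index (levelGroup n H)
  rw [card_levelFun] at h1
  have h2 : 2 ≤ (levelGroup n H).index := by
    have h3 : (levelGroup n H).index ≠ 0 := fun h0 => by
      rw [h0, mul_zero] at h1
      exact (pow_pos two_pos (2 ^ n)).ne h1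
    have h4 : (levelGroup n H).index ≠ 1 := fun h0 => hn (AddSubgroup.index_eq_one.1 h0)
    omega
  refine AddSubgroup.eq_of_le_of_card_ge (levelGroup_succ_le hs n) ?_
  have h5 : Nat.card (levelGroup n H) * 2 ≤ 2 ^ 2 ^ n := by
    rw [← h1]
    exact Nat.mul_le_mul_left _ h2
  have h6 := Nat.pow_le_pow_left h5 2
  rw [← pow_mul, ← pow_succ, ← hc, mul_pow] at h6
  rw [card_square]
  omega

theorem levelGroup_eq_top_of_succ {H : Subgroup TreeAut} {n : ℕ} (hs : IsSelfSimilar H)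
    (h : levelGroup (n + 1) H = ⊤) : levelGroup n H = ⊤ := by
  refine eq_top_iff.2 fun v _ => ?_
  have := levelGroup_succ_le hs n (h ▸ AddSubgroup.mem_top (ofHalves fun _ => v)) false
  rwa [half_ofHalves] at this

theorem exists_mem_proj_eq_of_levelGroup_eq_top {H : Subgroup TreeAut} {n : ℕ}
    (hs : IsSelfSimilar H) (h : levelGroup n H = ⊤) (g : TreeAut) :
    ∃ h ∈ H, proj (n + 1) g = proj (n + 1) h := by
  induction n with
  | zero =>
    exact exists_mem_proj_succ_eq (one_mem H) (proj_zero_eq _ _) (h ▸ AddSubgroup.mem_top _)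
  | succ n ih =>
    obtain ⟨k, hk, e⟩ := ih (levelGroup_eq_top_of_succ hs h)
    exact exists_mem_proj_succ_eq hk e (h ▸ AddSubgroup.mem_top _)

/-! ### Invariant subgroups of index four -/

/-- `T` permutes the four cosets and fixes that of zero. A permutation of three points with trivial
fourth power has trivial square. -/
theorem iterate_two_sub_mem_of_index_eq_four {V : Type*} [AddCommGroup V] {W : AddSubgroup V}
    (hW : W.index = 4) (T : V → V) (hT : ∀ x y, x - y ∈ W → T x - T y ∈ W) (hT0 : T 0 = 0)
    (hT4 : ∀ v, T (T (T (T v))) = v) (v : V) : T (T v) - v ∈ W := by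
  by_contra hc
  have symm : ∀ x y, x - y ∈ W → y - x ∈ W := fun x y h => by simpa using W.neg_mem h
  have e1 : ∀ x, T x - x ∉ W → T (T x) - x ∉ W → T (T (T x)) - x ∉ W := by
    intro x h1 _ h3
    have := hT _ _ h3
    rw [hT4] at this
    exact h1 (symm _ _ this)
  have h1 : T v - v ∉ W := fun h => hc (by
    have := W.add_mem (hT _ _ h) h
    rwa [sub_add_sub_cancel] at this)
  have h0 : v ∉ W := fun h => by
    have h' : T v - T 0 ∈ W := hT _ _ (by rwa [sub_zero])
    rw [hT0, sub_zero] at h'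
    exact h1 (W.sub_mem h' h)
  have back : ∀ x y, T x - T y ∈ W → x - y ∈ W := fun x y h => by
    have := hT _ _ (hT _ _ (hT _ _ h))
    rwa [hT4, hT4] at this
  have back0 : ∀ x, T x ∈ W → x ∈ W := fun x h => by
    simpa using back x 0 (by rwa [hT0, sub_zero])
  let q : V → V ⧸ W := fun x => (x : V ⧸ W)
  have hq : ∀ x y, q x = q y → x - y ∈ W := fun x y h => by
    have := QuotientAddGroup.eq.1 h
    exact symm _ _ (by rwa [neg_add_eq_sub] at this)
  -- Otherwise zero and an orbit of length four give five distinct cosets.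
  have hnd : [q 0, q v, q (T v), q (T (T v)), q (T (T (T v)))].Nodup := by
    have z : ∀ x, x ∉ W → q 0 ≠ q x := fun x hx h => hx (by simpa using symm _ _ (hq _ _ h))
    have ne : ∀ x y, y - x ∉ W → q x ≠ q y := fun x y hx h => hx (symm _ _ (hq _ _ h))
    have b1 : ∀ {x y}, x - y ∉ W → T x - T y ∉ W := fun h h' => h (back _ _ h')
    have b0 : ∀ {x}, x ∉ W → T x ∉ W := fun h h' => h (back0 _ h')
    simp only [List.nodup_cons, List.mem_cons, List.not_mem_nil, or_false, not_or,
      List.nodup_nil, and_true, not_false_eq_true]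
    exact ⟨⟨z _ h0, z _ (b0 h0), z _ (b0 (b0 h0)), z _ (b0 (b0 (b0 h0)))⟩,
      ⟨ne _ _ h1, ne _ _ hc, ne _ _ (e1 _ h1 hc)⟩, ⟨ne _ _ (b1 h1), ne _ _ (b1 hc)⟩,
      ne _ _ (b1 (b1 h1))⟩
  have hfin : Finite (V ⧸ W) := Nat.finite_of_card_ne_zero (by
    rw [← AddSubgroup.index, hW]; norm_num)
  have := Fintype.ofFinite (V ⧸ W)
  have hle := hnd.length_le_card
  rw [← Nat.card_eq_fintype_card, ← AddSubgroup.index, hW] at hle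
  simp at hle

/-- The functions on level `n` with sum zero. -/
def sumZero (n : ℕ) : AddSubgroup (LevelFun n) where
  carrier := {v | ∑ w, v w = 0}
  zero_mem' := by simp
  add_mem' hv hw := by
    simp only [Set.mem_ofPred_eq, Pi.add_apply, Finset.sum_add_distrib] at *
    rw [hv, hw, add_zero]
  neg_mem' hv := by
    simp only [Set.mem_ofPred_eq, Pi.neg_apply, Finset.sum_neg_distrib] at *
    rw [hv, neg_zero]

theorem mem_sumZero {n : ℕ} {v : LevelFun n} : v ∈ sumZero n ↔ ∑ w, v w = 0 := Iff.rfl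

theorem two_mul_card_sumZero (n : ℕ) : 2 * Nat.card (sumZero n) = 2 ^ 2 ^ n := by
  let f : LevelFun n →+ ZMod 2 :=
    { toFun := fun v => ∑ w, v w
      map_zero' := by simp
      map_add' := fun v w => Finset.sum_add_distrib }
  have hker : f.ker = sumZero n := rfl
  have hsurj : Function.Surjective f := fun a =>
    ⟨Pi.single (List.Vector.replicate n false) a, by
      show ∑ w, (Pi.single _ a : LevelFun n) w = a
      rw [Finset.sum_pi_single']
      simp⟩
  have h := AddSubgroup.card_mul_index f.ker
  rw [AddSubgroup.index_ker, AddMonoidHom.range_eq_top.2 hsurj, card_levelFun, hker,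
    Nat.card_congr AddSubgroup.topEquiv.toEquiv, Nat.card_zmod] at h
  rw [← h, mul_comm]

theorem four_mul_card_square_sumZero (n : ℕ) :
    4 * Nat.card (square (sumZero n)) = 2 ^ 2 ^ (n + 1) := by
  rw [card_square, pow_succ 2 n, pow_mul 2 (2 ^ n), ← two_mul_card_sumZero]
  ring

/-- Words of length `n + 1` are pairs of a letter and a word of length `n`. -/
def consEquiv (n : ℕ) : Bool × List.Vector Bool n ≃ List.Vector Bool (n + 1) where
  toFun p := p.1 ::ᵥ p.2
  invFun w := (w.head, w.tail)
  left_inv _ := rfl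
  right_inv w := List.Vector.cons_head_tail w

/-- Modulo `W` all basis vectors within one half coincide, so the class of a function depends only
on its two half-sums. -/
theorem square_sumZero_le {n : ℕ} {W : AddSubgroup (LevelFun (n + 1))}
    (hW : ∀ (x : Bool) (u u' : List.Vector Bool n),
      (Pi.single (x ::ᵥ u') 1 - Pi.single (x ::ᵥ u) 1 : LevelFun (n + 1)) ∈ W) :
    square (sumZero n) ≤ W := by
  intro v hv
  let q : LevelFun (n + 1) →+ LevelFun (n + 1) ⧸ W := QuotientAddGroup.mk' W
  let u₀ : List.Vector Bool n := List.Vector.replicate n false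
  let r : Bool → ZMod 2 →+ LevelFun (n + 1) ⧸ W := fun x =>
    q.comp (AddMonoidHom.single (fun _ => ZMod 2) (x ::ᵥ u₀))
  have hr : ∀ x u a, q (Pi.single (x ::ᵥ u) a) = r x a := by
    intro x u a
    rcases zmod_two_cases a with rfl | rfl
    · simp
    · show q _ = q (Pi.single (x ::ᵥ u₀) 1)
      rw [← sub_eq_zero, ← map_sub]
      exact (QuotientAddGroup.eq_zero_iff _).2 (hW x u₀ u)
  refine (QuotientAddGroup.eq_zero_iff v).1 ?_
  show q v = 0
  rw [← Finset.univ_sum_single v, map_sum, ← Equiv.sum_comp (consEquiv n), Fintype.sum_prod_type]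
  refine Finset.sum_eq_zero fun x _ => ?_
  have h1 : ∀ u, q (Pi.single (consEquiv n (x, u)) (v (consEquiv n (x, u)))) =
      r x (half x v u) := fun u => hr x u _
  rw [Finset.sum_congr rfl fun u _ => h1 u, ← map_sum, mem_sumZero.1 (hv x), map_zero]

/-- Conjugation inside `H` permutes level portraits, and `H` induces every permutation that the tree
group does. -/
theorem comp_levelPerm_mem_levelGroup {H : Subgroup TreeAut} {n : ℕ}
    (hfull : ∀ g, ∃ h ∈ H, proj n g = proj n h) (g : TreeAut) {v : LevelFun n}
    (hv : v ∈ levelGroup n H) : v ∘ levelPerm n g ∈ levelGroup n H := by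
  obtain ⟨h, hh, e⟩ := hfull g
  obtain ⟨k, hk, hks, rfl⟩ := hv
  refine ⟨h⁻¹ * k * h⁻¹⁻¹, mul_mem (mul_mem (inv_mem hh) hk) (inv_mem (inv_mem hh)),
    (inferInstance : (levelStab n).Normal).conj_mem _ hks _, ?_⟩
  rw [level_conj _ hks, inv_inv]
  have : levelPerm n h = levelPerm n g := Equiv.ext fun w =>
    Subtype.ext (proj_eq_iff.1 e w.1 w.2.le).symm
  rw [this]

theorem levelGroup_eq_square_sumZero {H : Subgroup TreeAut} {n : ℕ}
    (hfull : ∀ g, ∃ h ∈ H, proj (n + 1) g = proj (n + 1) h)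
    (hc : 4 * Nat.card (levelGroup (n + 1) H) = 2 ^ 2 ^ (n + 1)) :
    levelGroup (n + 1) H = square (sumZero n) := by
  symm
  refine AddSubgroup.eq_of_le_of_card_ge (square_sumZero_le fun x u u' => ?_) (by
    have := four_mul_card_square_sumZero n
    omega)
  have hidx : (levelGroup (n + 1) H).index = 4 := by
    have h1 := AddSubgroup.card_mul_index (levelGroup (n + 1) H)
    rw [card_levelFun, ← hc, mul_comm 4] at h1
    exact Nat.eq_of_mul_eq_mul_left Nat.card_pos h1
  obtain ⟨k, hk, hk2⟩ := exists_involution_apply_eq (u'.2.trans u.2.symm)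
  -- `g` swaps the letters with `k` on only one side, so `g * g` acts as the involution `k` on both
  -- halves and carries `x ::ᵥ u'` to `x ::ᵥ u`.
  let g : TreeAut := ofSections 1 fun y => if y then 1 else k
  have hgg : ∀ y w, g (g (y :: w)) = y :: k w := by
    intro y w
    rw [apply_cons g y, apply_cons g]
    simp only [g, treeSection_ofSections, act_ofSections_nil, flip_one]
    cases y <;> simp
  have hkk : ∀ w, k (k w) = w := fun w => by
    rw [← RelIso.mul_apply, hk2, RelIso.one_apply]
  have hg4 : ∀ w, g (g (g (g w))) = w := by
    rintro (_ | ⟨y, w⟩)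
    · simp only [treeAut_nil]
    · rw [hgg, hgg, hkk]
  have key := iterate_two_sub_mem_of_index_eq_four hidx (fun v => v ∘ levelPerm (n + 1) g)
    (fun v w h => comp_levelPerm_mem_levelGroup hfull g h) rfl
    (fun v => funext fun w => congrArg v (Subtype.ext (hg4 w.1))) (Pi.single (x ::ᵥ u) 1)
  convert key using 1
  congr 1
  funext w
  have hw : w = x ::ᵥ u' ↔ levelPerm (n + 1) g (levelPerm (n + 1) g w) = x ::ᵥ u := by
    have : levelPerm (n + 1) g (levelPerm (n + 1) g (x ::ᵥ u')) = x ::ᵥ u :=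
      Subtype.ext ((hgg x u'.1).trans (congrArg _ hk))
    rw [← this, (levelPerm (n + 1) g).injective.eq_iff, (levelPerm (n + 1) g).injective.eq_iff]
  simp only [Function.comp_apply, Pi.single_apply, hw]


/-! ### The pattern groups with kernel `square (sumZero n)` -/

/-- The coefficients of a constraint on patterns of size `n + 2`. -/
abbrev Coeffs (n : ℕ) : Type := (Fin n → ZMod 2) × (Fin n → ZMod 2) × ZMod 2

/-- The part of the constraint that only depends on the levels up to `n` of `g`. -/
noncomputable def lowDefect {n : ℕ} (p : Coeffs n) (x : Bool) (g : TreeAut) : ZMod 2 :=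
  ∑ i, p.1 i * levelSum i (treeSection g [x]) + ∑ i, p.2.1 i * levelSum i (treeSection g [!x]) +
    p.2.2 * act g []

/-- The deviation of `g` from the constraint with coefficients `p` at the letter `x`. -/
noncomputable def defect {n : ℕ} (p : Coeffs n) (x : Bool) (g : TreeAut) : ZMod 2 :=
  levelSum n (treeSection g [x]) + lowDefect p x g

theorem flip_not (a : ZMod 2) (x : Bool) : flip a (!x) = !flip a x := by
  revert a x; decide

/-- A cocycle identity. One triple of coefficients serves both letters because exchanging letters
commutes with the action on them; hence vanishing at both letters is multiplicative. -/
theorem defect_mul {n : ℕ} (p : Coeffs n) (x : Bool) (g h : TreeAut) :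
    defect p x (g * h) = defect p (flip (act h []) x) g + defect p x h := by
  simp only [defect, lowDefect, treeSection_mul_singleton, levelSum_mul, act_mul, treeAut_nil,
    flip_not, mul_add, Finset.sum_add_distrib]
  ring

theorem lowDefect_congr {n : ℕ} (p : Coeffs n) (x : Bool) {g h : TreeAut}
    (e : proj (n + 1) g = proj (n + 1) h) : lowDefect p x g = lowDefect p x h := by
  have hs : ∀ y (i : Fin n), levelSum i (treeSection g [y]) = levelSum i (treeSection h [y]) :=
    fun y i => levelSum_congr
      (proj_eq_of_le (Nat.succ_le_of_lt i.2) (proj_treeSection_singleton_eq y e))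
  simp only [lowDefect, hs, proj_eq_iff_act.1 e [] (Nat.succ_pos n)]

theorem defect_congr {n : ℕ} (p : Coeffs n) (x : Bool) {g h : TreeAut}
    (e : proj (n + 2) g = proj (n + 2) h) : defect p x g = defect p x h := by
  rw [defect, defect, lowDefect_congr p x (proj_eq_of_le (Nat.le_succ _) e),
    levelSum_congr (proj_treeSection_singleton_eq x e)]

theorem lowDefect_one {n : ℕ} (p : Coeffs n) (x : Bool) : lowDefect p x 1 = 0 := by
  simp [lowDefect, treeSection_one, levelSum_one]

theorem defect_one {n : ℕ} (p : Coeffs n) (x : Bool) : defect p x 1 = 0 := by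
  rw [defect, lowDefect_one, treeSection_one, levelSum_one, add_zero]

theorem defect_of_mem_levelStab {n : ℕ} (p : Coeffs n) (x : Bool) {g : TreeAut}
    (hg : g ∈ levelStab (n + 1)) : defect p x g = ∑ u, half x (level (n + 1) g) u := by
  rw [defect, lowDefect_congr p x (h := 1) (hg.trans (map_one _).symm), lowDefect_one, add_zero,
    levelSum_eq, level_treeSection]

/-- The group of automorphisms all of whose sections satisfy the constraint with
coefficients `p`. -/
def constraintGroup {n : ℕ} (p : Coeffs n) : Subgroup TreeAut where
  carrier := {g | ∀ w x, defect p x (treeSection g w) = 0}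
  one_mem' w x := by rw [treeSection_one, defect_one]
  mul_mem' := fun {g h} hg hh w x => by
    rw [treeSection_mul, defect_mul, hg, hh, add_zero]
  inv_mem' := fun {g} hg w x => by
    have h1 := defect_mul p x (treeSection g (g⁻¹ w)) (treeSection g (g⁻¹ w))⁻¹
    rwa [mul_inv_cancel, defect_one, hg, zero_add, ← treeSection_inv, eq_comm] at h1

theorem mem_constraintGroup {n : ℕ} {p : Coeffs n} {g : TreeAut} :
    g ∈ constraintGroup p ↔ ∀ w x, defect p x (treeSection g w) = 0 := Iff.rfl

theorem isSelfSimilar_constraintGroup {n : ℕ} (p : Coeffs n) :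
    IsSelfSimilar (constraintGroup p) := fun g hg w v x => by
  rw [← treeSection_append]
  exact hg _ x

theorem defect_eq_zero_of_mem {n : ℕ} {p : Coeffs n} {g : TreeAut}
    (hg : g ∈ constraintGroup p) (x : Bool) : defect p x g = 0 := by
  rw [← treeSection_nil g]
  exact hg [] x

theorem isOfFiniteType_constraintGroup {n : ℕ} (p : Coeffs n) :
    IsOfFiniteType (constraintGroup p) (n + 2) := fun g hg w x => by
  obtain ⟨h, hh, e⟩ := hg w
  rw [defect_congr p x e, defect_eq_zero_of_mem hh]

theorem exists_defect_eq_zero {n : ℕ} (p : Coeffs n) (g : TreeAut) :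
    ∃ h, proj (n + 1) h = proj (n + 1) g ∧ ∀ x, defect p x h = 0 := by
  let u₀ : List.Vector Bool n := List.Vector.replicate n false
  -- In `k * g` the half of `k` seen from `x` is the one at `flip (act g []) x`, hence the flipped
  -- letter in the correction.
  let k : TreeAut := ofLevel (n + 1) (ofHalves fun y =>
    Pi.single u₀ (-defect p (flip (act g []) y) g))
  have hk : k ∈ levelStab (n + 1) := ofLevel_mem _ _
  refine ⟨k * g, ?_, fun x => ?_⟩
  · rw [map_mul, show proj (n + 1) k = 1 from hk, one_mul]
  · rw [defect_mul, defect_of_mem_levelStab p _ hk, level_ofLevel, half_ofHalves,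
      Finset.sum_pi_single', if_pos (Finset.mem_univ _), flip_flip_self, neg_add_cancel]

/-- An automorphism that agrees with `g` to level `n + 1` and satisfies the constraint. -/
noncomputable def adjust {n : ℕ} (p : Coeffs n) (g : TreeAut) : TreeAut :=
  (exists_defect_eq_zero p g).choose

theorem proj_adjust {n : ℕ} (p : Coeffs n) (g : TreeAut) :
    proj (n + 1) (adjust p g) = proj (n + 1) g := (exists_defect_eq_zero p g).choose_spec.1

theorem defect_adjust {n : ℕ} (p : Coeffs n) (g : TreeAut) (x : Bool) :
    defect p x (adjust p g) = 0 := (exists_defect_eq_zero p g).choose_spec.2 x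

/-- The automorphism whose pattern is used at `w` in the extension of the pattern of `g`. -/
noncomputable def localModel {n : ℕ} (p : Coeffs n) : TreeAut → List Bool → TreeAut
  | g, [] => g
  | g, x :: w => localModel p (adjust p (treeSection g [x])) w

theorem localModel_append {n : ℕ} (p : Coeffs n) (g : TreeAut) (w v : List Bool) :
    localModel p g (w ++ v) = localModel p (localModel p g w) v := by
  induction w generalizing g with
  | nil => rfl
  | cons x w ih => exact ih _

theorem defect_localModel {n : ℕ} (p : Coeffs n) {g : TreeAut} (hg : ∀ x, defect p x g = 0)
    (w : List Bool) (x : Bool) : defect p x (localModel p g w) = 0 := by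
  induction w generalizing g with
  | nil => exact hg x
  | cons y w ih => exact ih (defect_adjust p _)

/-- The extension of the pattern of size `n + 2` of `g` to an element of the constraint group. -/
noncomputable def extend {n : ℕ} (p : Coeffs n) (g : TreeAut) : TreeAut :=
  ofPortrait fun w => act (localModel p g w) []

theorem treeSection_extend {n : ℕ} (p : Coeffs n) (g : TreeAut) (w : List Bool) :
    treeSection (extend p g) w = extend p (localModel p g w) :=
  treeAut_ext fun v => by
    rw [act_treeSection, extend, extend, act_ofPortrait, act_ofPortrait, localModel_append]

/-- `adjust` preserves a section's first `n + 1` levels of activities, which are all that a pattern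
of size `n + 2` sees below a letter. -/
theorem proj_extend {n : ℕ} (p : Coeffs n) (g : TreeAut) :
    proj (n + 2) (extend p g) = proj (n + 2) g := by
  rw [proj_eq_iff_act]
  intro w
  induction w generalizing g with
  | nil =>
    intro _
    rw [extend, act_ofPortrait, localModel]
  | cons x w ih =>
    intro hw
    have h1 := ih (adjust p (treeSection g [x])) (by rw [List.length_cons] at hw; omega)
    rw [proj_eq_iff_act.1 (proj_adjust p _) w (by rw [List.length_cons] at hw; omega)] at h1
    have h2 := congrArg (fun k => act k w) (treeSection_extend p g [x])
    simp only [act_treeSection, List.singleton_append, localModel] at h1 h2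
    rw [h2, h1]

theorem exists_mem_constraintGroup {n : ℕ} (p : Coeffs n) {g : TreeAut}
    (hg : ∀ x, defect p x g = 0) : ∃ h ∈ constraintGroup p, proj (n + 2) g = proj (n + 2) h := by
  refine ⟨extend p g, fun w x => ?_, (proj_extend p g).symm⟩
  rw [treeSection_extend, defect_congr p x (proj_extend p _), defect_localModel p hg]

theorem exists_mem_constraintGroup_proj_eq {n : ℕ} (p : Coeffs n) (g : TreeAut) :
    ∃ h ∈ constraintGroup p, proj (n + 1) g = proj (n + 1) h := by
  obtain ⟨k, hk, hk'⟩ := exists_defect_eq_zero p g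
  obtain ⟨h, hh, e⟩ := exists_mem_constraintGroup p hk'
  exact ⟨h, hh, hk.symm.trans (proj_eq_of_le (Nat.le_succ _) e)⟩

theorem levelGroup_constraintGroup {n : ℕ} (p : Coeffs n) :
    levelGroup (n + 1) (constraintGroup p) = square (sumZero n) := by
  ext v
  constructor
  · rintro ⟨h, hh, hs, rfl⟩ x
    rw [mem_sumZero, ← defect_of_mem_levelStab p x hs, defect_eq_zero_of_mem hh]
  · intro hv
    obtain ⟨h, hh, e⟩ := exists_mem_constraintGroup p (g := ofLevel (n + 1) v) fun x => by
      rw [defect_of_mem_levelStab p x (ofLevel_mem _ _), level_ofLevel, ← mem_sumZero]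
      exact hv x
    obtain ⟨e1, e2⟩ := proj_succ_eq_iff.1 e
    exact ⟨h, hh, e1.symm.trans (ofLevel_mem _ _), by rw [← e2, level_ofLevel]⟩

theorem card_levelGroup_constraintGroup {n : ℕ} (p : Coeffs n) :
    4 * Nat.card (levelGroup (n + 1) (constraintGroup p)) = 2 ^ 2 ^ (n + 1) := by
  rw [levelGroup_constraintGroup, four_mul_card_square_sumZero]

/-- The group maps onto `FinTreeAut (n + 1)`, so smaller patterns would impose nothing and give the
whole tree group, against index four. -/
theorem isDefinedByPatternsOfSize_constraintGroup {n : ℕ} (p : Coeffs n) :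
    IsDefinedByPatternsOfSize (constraintGroup p) (n + 2) := by
  refine ⟨hasPatternsOfSize_iff.2 ⟨by omega, isSelfSimilar_constraintGroup p,
    isOfFiniteType_constraintGroup p⟩, fun d hd => ?_⟩
  obtain ⟨-, -, hf⟩ := hasPatternsOfSize_iff.1 hd
  by_contra hlt
  have htop : constraintGroup p = ⊤ := eq_top_iff.2 fun g _ => hf g fun w => by
    obtain ⟨h, hh, e⟩ := exists_mem_constraintGroup_proj_eq p (treeSection g w)
    exact ⟨h, hh, proj_eq_of_le (by omega) e⟩
  have h1 := card_levelGroup_constraintGroup p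
  have h2 : levelGroup (n + 1) (constraintGroup p) = ⊤ := by
    rw [htop]
    exact eq_top_iff.2 fun v _ =>
      ⟨ofLevel _ v, Subgroup.mem_top _, ofLevel_mem _ v, level_ofLevel _ v⟩
  rw [h2, Nat.card_congr AddSubgroup.topEquiv.toEquiv, card_levelFun] at h1
  have := pow_pos (two_pos (α := ℕ)) (2 ^ (n + 1))
  omega

theorem levelSum_ofLevel_single {n : ℕ} (i j : Fin n) (u : List.Vector Bool i) :
    levelSum j (ofLevel i (Pi.single u 1)) = if j = i then 1 else 0 := by
  split_ifs with h
  · subst h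
    rw [levelSum_eq, level_ofLevel, Finset.sum_pi_single', if_pos (Finset.mem_univ _)]
  · refine Finset.sum_eq_zero fun w _ => ?_
    rw [ofLevel, act_ofPortrait, dif_neg]
    rw [w.2]
    exact fun e => h (Fin.ext e)

/-- Every `g` agrees to level `n + 1` with an element of the group, whose half-sums are forced; so
the group determines `lowDefect`, and test elements isolate each coefficient. -/
theorem constraintGroup_injective (n : ℕ) :
    Function.Injective (constraintGroup : Coeffs n → Subgroup TreeAut) := by
  intro p q hpq
  have h1 : ∀ x g, lowDefect p x g = lowDefect q x g := by
    intro x g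
    obtain ⟨k, hk, hk0⟩ := exists_defect_eq_zero p g
    obtain ⟨h, hh, e⟩ := exists_mem_constraintGroup p hk0
    have h2 := hk0 x
    have h3 : defect q x k = 0 := by
      rw [defect_congr q x e]
      rw [hpq] at hh
      exact defect_eq_zero_of_mem hh x
    rw [← lowDefect_congr p x hk, ← lowDefect_congr q x hk]
    rw [defect] at h2 h3
    exact add_left_cancel (h2.trans h3.symm)
  have h2 : ∀ i, p.1 i = q.1 i ∧ p.2.1 i = q.2.1 i := by
    intro i
    let k : TreeAut := ofLevel i (Pi.single (List.Vector.replicate i false) 1)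
    have h3 : ∀ (r : Coeffs n) x, lowDefect r x
        (ofSections 0 fun y => if y then 1 else k) = if x then r.2.1 i else r.1 i := by
      intro r x
      cases x <;>
        simp [lowDefect, levelSum_one, k, levelSum_ofLevel_single]
    have h4 := h1 false (ofSections 0 fun y => if y then 1 else k)
    have h5 := h1 true (ofSections 0 fun y => if y then 1 else k)
    rw [h3, h3] at h4 h5
    exact ⟨by simpa using h4, by simpa using h5⟩
  have h3 : p.2.2 = q.2.2 := by
    simpa [lowDefect, levelSum_one] using h1 false (ofSections 1 fun _ => 1)
  exact Prod.ext (funext fun i => (h2 i).1) (Prod.ext (funext fun i => (h2 i).2) h3)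

/-! ### Every such group is a constraint group -/

/-- The automorphism that fixes the letters and has section `k` at `x` and trivial section at the
other letter. -/
noncomputable def inLetter (x : Bool) (k : TreeAut) : TreeAut :=
  ofSections 0 fun y => if y = x then k else 1

@[simp] theorem act_inLetter_nil (x : Bool) (k : TreeAut) : act (inLetter x k) [] = 0 :=
  act_ofSections_nil _ _

@[simp] theorem treeSection_inLetter (x y : Bool) (k : TreeAut) :
    treeSection (inLetter x k) [y] = if y = x then k else 1 :=
  treeSection_ofSections _ _ _

theorem inLetter_mul (x : Bool) (k l : TreeAut) :
    inLetter x (k * l) = inLetter x k * inLetter x l := by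
  refine treeAut_ext_sections (by simp [act_mul, treeAut_nil]) fun y => ?_
  rw [treeSection_mul_singleton]
  simp only [treeSection_inLetter, act_inLetter_nil, flip_zero]
  split_ifs <;> simp

theorem inLetter_mem_levelStab {n : ℕ} (x : Bool) {k : TreeAut} (hk : k ∈ levelStab n) :
    inLetter x k ∈ levelStab (n + 1) := mem_levelStab.2 fun w hw => by
  rcases w with _ | ⟨y, w⟩
  · simp
  · rw [inLetter, act_ofSections_cons]
    split_ifs
    · exact mem_levelStab.1 hk w (by simpa using hw)
    · exact act_one w

/-- The automorphism with activity `a` at the root and no others. -/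
noncomputable def rootFlip (a : ZMod 2) : TreeAut := ofSections a fun _ => 1

theorem rootFlip_mul_inLetter (g : TreeAut) :
    g = rootFlip (act g []) * (inLetter false (treeSection g [false]) *
      inLetter true (treeSection g [true])) := by
  refine treeAut_ext_sections (by simp [act_mul, treeAut_nil, rootFlip]) fun y => ?_
  rw [treeSection_mul_singleton, treeSection_mul_singleton]
  cases y <;> simp [rootFlip]

theorem inLetter_not (x : Bool) (k : TreeAut) :
    inLetter (!x) k = rootFlip 1 * (inLetter x k * rootFlip 1) := by
  refine treeAut_ext_sections (by simp [act_mul, treeAut_nil, rootFlip, add_self_zmod_two])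
    fun y => ?_
  rw [treeSection_mul_singleton, treeSection_mul_singleton]
  cases x <;> cases y <;> simp [rootFlip, flip_one]

theorem rootFlip_mul_self (a : ZMod 2) : rootFlip a * rootFlip a = 1 := by
  refine treeAut_ext_sections (by simp [act_mul, treeAut_nil, rootFlip, add_self_zmod_two])
    fun y => ?_
  rw [treeSection_mul_singleton]
  simp [rootFlip, treeSection_one]

theorem rootFlip_zero : rootFlip 0 = 1 :=
  treeAut_ext_sections (by simp [rootFlip]) fun y => by simp [rootFlip, treeSection_one]

/-- A cocycle on `Aut(X^*)` with values in the permutation module on the two letters, which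
extends the sums of the activities on the two halves of level `n + 1`, is a defect. -/
theorem exists_coeffs_of_cocycle {n : ℕ} (f : Bool → TreeAut → ZMod 2)
    (hmul : ∀ x g h, f x (g * h) = f (flip (act h []) x) g + f x h)
    (hstab : ∀ x, ∀ g ∈ levelStab (n + 1), f x g = levelSum n (treeSection g [x])) :
    ∃ p : Coeffs n, ∀ x g, f x g = defect p x g := by
  have hone : ∀ x, f x 1 = 0 := fun x => by
    rw [hstab x 1 (one_mem _), treeSection_one, levelSum_one]
  have hmul0 : ∀ x g h, act h [] = 0 → f x (g * h) = f x g + f x h := fun x g h e => by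
    rw [hmul, e, flip_zero]
  -- The root flip is an involution, which forces equal values at the two letters: one bit.
  have hroot : ∀ x a, f x (rootFlip a) = f false (rootFlip 1) * a := by
    have h1 : f true (rootFlip 1) = f false (rootFlip 1) := by
      have h2 := hmul true (rootFlip 1) (rootFlip 1)
      rw [rootFlip_mul_self, hone, rootFlip, act_ofSections_nil, flip_one] at h2
      exact (CharTwo.add_eq_zero.1 h2.symm).symm
    intro x a
    rcases zmod_two_cases a with rfl | rfl
    · rw [rootFlip_zero, hone, mul_zero]
    · rw [mul_one]
      cases x
      · rfl
      · exact h1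
  -- Conjugation by the root flip exchanges the subtrees, its two contributions cancelling, so the
  -- component at `false` determines the one at `true`.
  have hswap : ∀ x y k, f (!x) (inLetter (!y) k) = f x (inLetter y k) := by
    intro x y k
    have e : act (inLetter y k * rootFlip 1) [] = 1 := by
      simp [act_mul, treeAut_nil, rootFlip]
    have e' : act (rootFlip 1) [] = 1 := act_ofSections_nil _ _
    rw [inLetter_not, hmul, hmul, e, e', flip_one, Bool.not_not, hroot x, hroot (!x)]
    linear_combination add_self_zmod_two (f false (rootFlip 1) * 1)
  have hlevel : ∀ x y, ∀ k ∈ levelStab n,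
      f x (inLetter y k) = if x = y then levelSum n k else 0 := by
    intro x y k hk
    rw [hstab x _ (inLetter_mem_levelStab y hk), treeSection_inLetter]
    split_ifs
    · rfl
    · exact levelSum_one n
  have hhom : ∀ x y k l, f x (inLetter y (k * l)) = f x (inLetter y k) + f x (inLetter y l) :=
    fun x y k l => by rw [inLetter_mul, hmul0 _ _ _ (act_inLetter_nil y l)]
  -- On level `n` of the subtree at `false` the cocycle is prescribed to be the sum; removing it
  -- leaves a homomorphism that sees only lower levels.
  obtain ⟨a, ha⟩ := exists_levelSum_combination n
    (fun k => f false (inLetter false k) - levelSum n k)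
    (fun k l => by rw [hhom, levelSum_mul]; ring)
    (fun k hk => by rw [hlevel _ _ k hk, if_pos rfl, sub_self])
  obtain ⟨b, hb⟩ := exists_levelSum_combination n (fun k => f false (inLetter true k))
    (hhom false true) (fun k hk => by rw [hlevel _ _ k hk, if_neg Bool.false_ne_true])
  refine ⟨(a, b, f false (rootFlip 1)), fun x g => ?_⟩
  have hg : f x g = f x (rootFlip (act g [])) + (f x (inLetter false (treeSection g [false])) +
      f x (inLetter true (treeSection g [true]))) := by
    conv_lhs => rw [rootFlip_mul_inLetter g]
    rw [hmul0 _ _ _ (by simp [act_mul, treeAut_nil]), hmul0 _ _ _ (act_inLetter_nil _ _)]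
  have hsame : ∀ k, f false (inLetter false k) = levelSum n k + ∑ i, a i * levelSum i k :=
    fun k => by rw [← ha k]; ring
  rw [hg, hroot, defect, lowDefect]
  cases x
  · rw [hsame, hb]
    simp only [Bool.not_false]
    ring
  · rw [show f true (inLetter false _) = _ from hswap false true _,
      show f true (inLetter true _) = _ from hswap false false _, hsame, hb]
    simp only [Bool.not_true]
    ring

/-- Compare the half-sums of `g` with those of an element of `H` agreeing with `g` to level `n + 1`.
The difference is a cocycle that vanishes exactly when the pattern of `g` occurs in `H`. -/
theorem exists_eq_constraintGroup {H : Subgroup TreeAut} {n : ℕ} (hs : IsSelfSimilar H)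
    (hf : IsOfFiniteType H (n + 2)) (hfull : ∀ g, ∃ h ∈ H, proj (n + 1) g = proj (n + 1) h)
    (hW : levelGroup (n + 1) H = square (sumZero n)) : ∃ p : Coeffs n, constraintGroup p = H := by
  have hzero : ∀ x, ∀ k ∈ H, k ∈ levelStab (n + 1) → levelSum n (treeSection k [x]) = 0 := by
    intro x k hk hks
    have : level (n + 1) k ∈ square (sumZero n) := hW ▸ ⟨k, hk, hks, rfl⟩
    rw [levelSum_eq, level_treeSection]
    exact this x
  have hindep : ∀ x, ∀ h ∈ H, ∀ h' ∈ H, proj (n + 1) h = proj (n + 1) h' →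
      levelSum n (treeSection h [x]) = levelSum n (treeSection h' [x]) := by
    intro x h hh h' hh' e
    have h1 : levelSum n (treeSection (h * h'⁻¹ * h') [x]) =
        levelSum n (treeSection h' [x]) := by
      rw [treeSection_mul_singleton, levelSum_mul, hzero _ _ (mul_mem hh (inv_mem hh')), zero_add]
      rw [MonoidHom.mem_ker, map_mul, map_inv, e, mul_inv_cancel]
    rwa [inv_mul_cancel_right] at h1
  -- `η` need not be a homomorphism: by `hindep` the half-sums do not depend on the chosen
  -- representative.
  choose η hη hproj using hfull
  let f : Bool → TreeAut → ZMod 2 := fun x g =>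
    levelSum n (treeSection g [x]) + levelSum n (treeSection (η g) [x])
  have hfeq : ∀ x g, ∀ h ∈ H, proj (n + 1) g = proj (n + 1) h →
      f x g = levelSum n (treeSection g [x]) + levelSum n (treeSection h [x]) :=
    fun x g h hh e => by
      rw [← hindep x (η g) (hη g) h hh ((hproj g).symm.trans e)]
  obtain ⟨p, hp⟩ := exists_coeffs_of_cocycle (n := n) f (fun x g h => by
    rw [hfeq x (g * h) (η g * η h) (mul_mem (hη g) (hη h)) (by
        rw [map_mul, map_mul, hproj g, hproj h]), treeSection_mul_singleton,
      treeSection_mul_singleton, levelSum_mul, levelSum_mul,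
      ← proj_eq_iff_act.1 (hproj h) [] (Nat.succ_pos n)]
    simp only [f]
    ring) (fun x g hg => by
    rw [hfeq x g 1 (one_mem H) (hg.trans (map_one _).symm), treeSection_one, levelSum_one,
      add_zero])
  have hmem : ∀ g, (∀ x, f x g = 0) ↔ ∃ h ∈ H, proj (n + 2) g = proj (n + 2) h := by
    intro g
    constructor
    · intro h0
      refine exists_mem_proj_succ_eq (hη g) (hproj g) ?_
      rw [hW]
      intro x
      rw [← level_treeSection, mem_sumZero, ← levelSum_eq, treeSection_mul_singleton,
        levelSum_mul, treeSection_inv, levelSum_inv, apply_singleton]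
      exact h0 _
    · rintro ⟨h, hh, e⟩ x
      rw [hfeq x g h hh (proj_eq_of_le (Nat.le_succ _) e),
        levelSum_congr (proj_treeSection_singleton_eq x e), add_self_zmod_two]
  refine ⟨p, ?_⟩
  ext g
  rw [mem_constraintGroup]
  simp only [← hp]
  exact ⟨fun h => hf g fun w => (hmem _).1 (h w),
    fun h w => (hmem _).2 ⟨_, hs g h w, rfl⟩⟩

/-! ### Classification and count -/

theorem setOf_hausdorffDim_eq_range (n : ℕ) :
    {H : Subgroup TreeAut | IsDefinedByPatternsOfSize H (n + 2) ∧
      hausdorffDim H = ENNReal.ofReal (1 - 2 / 2 ^ (n + 1))} =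
    Set.range (constraintGroup : Coeffs n → Subgroup TreeAut) := by
  ext H
  constructor
  · rintro ⟨⟨hH, hmin⟩, hdim⟩
    obtain ⟨-, hs, hf⟩ := hasPatternsOfSize_iff.1 hH
    have hc := (hausdorffDim_eq_iff hs hf).1 hdim
    have htop : levelGroup n H = ⊤ := by
      by_contra hne
      have := hmin (hasPatternsOfSize_iff.2 ⟨Nat.le_add_left 1 n, hs,
        hf.of_levelGroup_eq hs (levelGroup_succ_eq_of_card hs hc hne)⟩)
      omega
    have hfull := exists_mem_proj_eq_of_levelGroup_eq_top hs htop
    exact exists_eq_constraintGroup hs hf hfull (levelGroup_eq_square_sumZero hfull hc)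
  · rintro ⟨p, rfl⟩
    exact ⟨isDefinedByPatternsOfSize_constraintGroup p,
      (hausdorffDim_eq_iff (isSelfSimilar_constraintGroup p)
        (isOfFiniteType_constraintGroup p)).2 (card_levelGroup_constraintGroup p)⟩

theorem card_coeffs (n : ℕ) : Nat.card (Coeffs n) = 2 ^ (2 * n + 1) := by
  simp only [Nat.card_prod, Nat.card_fun, Nat.card_zmod, Nat.card_fin]
  ring

end BinaryTree

theorem theorem1p1 (d : ℕ) (hd : 2 ≤ d) :
    {H : Subgroup BinaryTree.TreeAut |
      BinaryTree.IsDefinedByPatternsOfSize H d ∧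
      BinaryTree.hausdorffDim H = ENNReal.ofReal (1 - 2 / 2 ^ (d - 1))}.ncard =
    2 ^ (2 * d - 3) := by
  obtain ⟨n, rfl⟩ := Nat.exists_eq_add_of_le' hd
  rw [show n + 2 - 1 = n + 1 by omega, BinaryTree.setOf_hausdorffDim_eq_range,
    show 2 * (n + 2) - 3 = 2 * n + 1 by omega, ← BinaryTree.card_coeffs,
    ← Nat.card_range_of_injective (BinaryTree.constraintGroup_injective n)]
  rfl
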